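/- Let $F:\mathbb R^d\to\mathbb R$ be bounded below, $F^{\inf}=\inf F$, and differentiable with $\|\nabla F(x)-\nabla F(y)\|\le L_1\|x-y\|$ for all $x,y$. Let $\nabla f(x,\xi)$, $\xi\sim\mathcal D$, be a stochastic gradient oracle, measurable in $(x,\xi)$, such that for some $p\in(1,2]$, $\sigma_1>0$, $q\in[1,2]$, $\delta\ge 0$ and all $x,y\in\mathbb R^d$, $$\mathbb E_\xi[\nabla f(x,\xi)]=\nabla F(x),\qquad \mathbb E_\xi\|\nabla f(x,\xi)-\nabla F(x)\|^p\le\sigma_1^p,$$ $$\mathbb E_\xi\big\|[\nabla f(x,\xi)-\nabla f(y,\xi)]-[\nabla F(x)-\nabla F(y)]\big\|^q\le\delta^q\|x-y\|^q .$$ Let $T\ge1$ be an integer, $\beta\in(0,1]$, $\ell=\log\frac{8T}{\beta}$, $x_0\in\mathbb R^d$ and $\Delta=F(x_0)-F^{\inf}$. Let $\mathrm{clip}(v,\lambda)=\min\{1,\lambda/\|v\|\}\,v$ (and $\mathrm{clip}(0,\lambda)=0$). Double-Clipped NSGD-MVR with parameters $\gamma,\alpha,\lambda_1,\lambda_2$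 starts from $x_0$ and $g_0=0$, puts $x_1=x_0-\gamma\, g_0/\|g_0\|$ and, for $t=1,\dots,T-1$, with $\xi_1,\xi_2,\dots$ i.i.d. from $\mathcal D$, $$g_t=(1-\alpha)\big(g_{t-1}+\mathrm{clip}(\nabla f(x_t,\xi_t)-\nabla f(x_{t-1},\xi_t),\lambda_1)\big)+\alpha\,\mathrm{clip}(\nabla f(x_t,\xi_t),\lambda_2),\qquad x_{t+1}=x_t-\gamma\frac{g_t}{\|g_t\|},$$ where $0/\|0\|:=0$. Take $$\alpha=\max\Big\{T^{-\frac{p}{2p-1}},T^{-\frac{pq}{p(2q+1)-2q}}\Big\},\quad \lambda_1=\max\{2\gamma L_1,\gamma\delta\alpha^{-1/q}\},\quad \lambda_2=\max\{4\sqrt{L_1\Delta},\sigma_1\alpha^{-1/p}\},$$ $$M=\min\left\{\alpha\sqrt{\tfrac{\Delta}{L_1}},\ \frac{1}{\alpha T\ell}\sqrt{\tfrac{\Delta}{L_1}},\ \frac{\Delta}{\sigma_1\alpha^{\frac{p-1}{p}}T\ell},\ \sqrt{\frac{\Delta\alpha^{1/q}}{\delta T\ell}},\ \sqrt{\frac{\Delta}{L_1T\ell}}\right\},$$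 where the term with $\delta$ is omitted if $\delta=0$, and $\Delta>0$ (which forces $L_1>0$) is assumed, so that $M>0$. Then there are absolute constants $c_0,C>0$ (independent of the dimension, the problem and all the parameters above) such that for every stepsize $0<\gamma\le c_0M$, with probability at least $1-\beta$, $$\frac1T\sum_{t=0}^{T-1}\|\nabla F(x_t)\|\le\frac{2\Delta}{\gamma T},$$ and if moreover $\gamma\ge cM$ with $c>0$, then with probability at least $1-\beta$, $$\frac1T\sum_{t=0}^{T-1}\|\nabla F(x_t)\|\le\frac{C}{c}\left(\frac{\sqrt{L_1\Delta}+\sigma_1}{T^{\min\{\frac{p-1}{2p-1},\,\frac{q(p-1)}{p(2q+1)-2q}\}}}\,\log\frac{8T}{\beta}+\frac{\sqrt{\delta\Delta}}{T^{\frac{q(p-1)}{p(2q+1)-2q}}}\sqrt{\log\frac{8T}{\beta}}\right);$$ if $T\ge2\beta$ (in particular if $T\ge 2$), then $\log\frac{8T}{\beta}$ may be replaced by $\log\frac{T}{\beta}$ in this last bound. -/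

import Mathlib

open MeasureTheory ProbabilityTheory

noncomputable section

namespace ClippedMVR

/-- `ℝ^d` with the Euclidean norm. -/
abbrev Pt (d : ℕ) : Type := EuclideanSpace ℝ (Fin d)

/-- `F` is differentiable and its gradient is `L₁`-Lipschitz. -/
def LipschitzGradient {d : ℕ} (F : Pt d → ℝ) (L₁ : ℝ) : Prop :=
  0 ≤ L₁ ∧ Differentiable ℝ F ∧ ∀ x y, ‖gradient F x - gradient F y‖ ≤ L₁ * ‖x - y‖

/-- The stochastic gradient oracle `G x ξ` with `ξ ∼ D` is unbiased for `∇F x` and has `p`-th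
central moment at most `σ₁ ^ p`, uniformly in `x`. -/
def BoundedCentralMoment {d : ℕ} {Ξ : Type*} [MeasurableSpace Ξ] (D : Measure Ξ)
    (F : Pt d → ℝ) (G : Pt d → Ξ → Pt d) (p σ₁ : ℝ) : Prop :=
  0 < σ₁ ∧ ∀ x,
    Integrable (G x) D ∧ ∫ ξ, G x ξ ∂D = gradient F x ∧
    Integrable (fun ξ => ‖G x ξ - gradient F x‖ ^ p) D ∧
    ∫ ξ, ‖G x ξ - gradient F x‖ ^ p ∂D ≤ σ₁ ^ p

/-- `(q, δ)`-similarity of the stochastic gradient oracle `G` to `∇F`. -/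
def Similarity {d : ℕ} {Ξ : Type*} [MeasurableSpace Ξ] (D : Measure Ξ)
    (F : Pt d → ℝ) (G : Pt d → Ξ → Pt d) (q δ : ℝ) : Prop :=
  0 ≤ δ ∧ ∀ x y,
    Integrable (fun ξ => ‖(G x ξ - G y ξ) - (gradient F x - gradient F y)‖ ^ q) D ∧
    ∫ ξ, ‖(G x ξ - G y ξ) - (gradient F x - gradient F y)‖ ^ q ∂D ≤ δ ^ q * ‖x - y‖ ^ q

/-- The samples `ξ 0, ξ 1, …` are independent with common law `D`. -/
def IIDSamples {Ω Ξ : Type*} [MeasurableSpace Ω] [MeasurableSpace Ξ]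
    (μ : Measure Ω) (D : Measure Ξ) (ξ : ℕ → Ω → Ξ) : Prop :=
  (∀ t, Measurable (ξ t)) ∧ iIndepFun ξ μ ∧ ∀ t, μ.map (ξ t) = D

/-- Clipping operator; the value at `v = 0` is `0`. -/
def clip {d : ℕ} (v : Pt d) (lam : ℝ) : Pt d := min 1 (lam / ‖v‖) • v

/-- One normalized step `x - γ g / ‖g‖`, which is `x` when `g = 0`. -/
def normStep {d : ℕ} (γ : ℝ) (x g : Pt d) : Pt d := x - (γ * ‖g‖⁻¹) • g

/-- The triple `(x_t, x_{t+1}, g_t)`. -/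
structure State (d : ℕ) where
  point : Pt d
  next : Pt d
  momentum : Pt d

/-- The run of Double-Clipped NSGD-MVR along a fixed realization `s` of the samples:
`x_1 = x_0 - γ g_0 / ‖g_0‖` and, for `t ≥ 1`,
`g_t = (1 - α) (g_{t-1} + clip (G x_t s_t - G x_{t-1} s_t) λ₁) + α clip (G x_t s_t) λ₂`,
`x_{t+1} = x_t - γ g_t / ‖g_t‖`. -/
def run {d : ℕ} {Ξ : Type*} (G : Pt d → Ξ → Pt d) (x₀ g₀ : Pt d) (γ α lam₁ lam₂ : ℝ)
    (s : ℕ → Ξ) : ℕ → State d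
  | 0 => ⟨x₀, normStep γ x₀ g₀, g₀⟩
  | t + 1 =>
    let prev := run G x₀ g₀ γ α lam₁ lam₂ s t
    let x := prev.next
    let g := (1 - α) • (prev.momentum + clip (G x (s (t + 1)) - G prev.point (s (t + 1))) lam₁)
      + α • clip (G x (s (t + 1))) lam₂
    ⟨x, normStep γ x g, g⟩

/-- The iterate `x_t`. -/
def iterate {d : ℕ} {Ξ : Type*} (G : Pt d → Ξ → Pt d) (x₀ g₀ : Pt d) (γ α lam₁ lam₂ : ℝ)
    (s : ℕ → Ξ) (t : ℕ) : Pt d :=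
  (run G x₀ g₀ γ α lam₁ lam₂ s t).point

/-- The average `(1/T) ∑_{t=0}^{T-1} ‖∇F(x_t)‖` along the sequence `x`. -/
def avgGradNorm {d : ℕ} (F : Pt d → ℝ) (x : ℕ → Pt d) (T : ℕ) : ℝ :=
  (1 / (T : ℝ)) * ∑ t ∈ Finset.range T, ‖gradient F (x t)‖

/-- The initial suboptimality `F(x₀) - inf F`. -/
def initialGap {d : ℕ} (F : Pt d → ℝ) (x₀ : Pt d) : ℝ := F x₀ - ⨅ x, F x

/-- The exponent `(p-1)/(2p-1)`. -/
def expo₁ (p : ℝ) : ℝ := (p - 1) / (2 * p - 1)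

/-- The exponent `q(p-1)/(p(2q+1)-2q)`. -/
def expo₂ (p q : ℝ) : ℝ := q * (p - 1) / (p * (2 * q + 1) - 2 * q)

/-- The momentum parameter `α = max {T^(-p/(2p-1)), T^(-pq/(p(2q+1)-2q))}`. -/
def momentumParam (p q : ℝ) (T : ℕ) : ℝ :=
  max ((T : ℝ) ^ (-(p / (2 * p - 1)))) ((T : ℝ) ^ (-(p * q / (p * (2 * q + 1) - 2 * q))))

/-- The clipping threshold for gradient differences. -/
def threshold₁ (L₁ δ q α γ : ℝ) : ℝ := max (2 * γ * L₁) (γ * δ * α ^ (-(1 / q)))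

/-- The clipping threshold for gradients. -/
def threshold₂ (L₁ σ₁ Δ p α : ℝ) : ℝ := max (4 * √(L₁ * Δ)) (σ₁ * α ^ (-(1 / p)))

/-- The minimum defining the stepsize, with `ℓ` the logarithmic factor. The last term, which has `δ`
in its denominator, is `+∞` for `δ = 0` and is then left out. -/
def stepScale (L₁ σ₁ δ Δ p q α : ℝ) (T : ℕ) (ℓ : ℝ) : ℝ :=
  let m := min (min (α * √(Δ / L₁)) (1 / (α * T * ℓ) * √(Δ / L₁)))
    (min (Δ / (σ₁ * α ^ ((p - 1) / p) * T * ℓ)) (√(Δ / (L₁ * T * ℓ))))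
  if δ = 0 then m else min m (√(Δ * α ^ (1 / q) / (δ * T * ℓ)))

/-- The convergence rate, with `ℓ` the logarithmic factor. -/
def rate (L₁ σ₁ δ Δ p q : ℝ) (T : ℕ) (ℓ : ℝ) : ℝ :=
  (√(L₁ * Δ) + σ₁) / (T : ℝ) ^ (min (expo₁ p) (expo₂ p q)) * ℓ
    + √(δ * Δ) / (T : ℝ) ^ (expo₂ p q) * √ℓ

end ClippedMVR

end

/-! Put B = λ₁ + αλ₂ and ℓ = log(8T/β). The momentum error g_t − ∇F(x_t) splits into S_t, the
exponentially weighted sum of the centred update directions (`noise`), and a remainder that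
contracts by 1 − α per step up to the clipping bias. The thresholds are chosen so that the p-th
(q-th) central moment of what is clipped is at most αλ^p (αλ^q). Clipping then leaves variance
O(αλ²), and bias O(αλ) as long as the clipped mean has norm at most λ/2.

Noise. In an inner product space, adding a centred vector of norm at most 1 and second moment v
multiplies E cosh‖·‖ by at most 1 + v, whatever the dimension (`integral_cosh_norm_add_le`). The
contraction by 1 − α compensates the growth when v ≤ α/2, so E cosh‖S_t/(4B)‖ ≤ 3 for all t
(`IIDSamples.integral_cosh_le`). Markov's inequality gives ‖S_t‖ ≤ 4Bℓ for all t < T, with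
probability at least 1 − β. The variance is measured around the clipped mean, and clipping is
1-Lipschitz; hence this part needs no bound on the gradients and no stopping time.

Descent. On that event the argument is deterministic (`LipschitzGradient.sum_norm_gradient_le`). The
bias bound needs ‖∇F(x_t)‖ ≤ λ₂/2, which smoothness gives as long as F(x_t) − inf F ≤ 2Δ. Strong
induction maintains this gap: the errors accumulated so far cost at most Δ by the stepsize
restriction (`stepsize_budget`). The same inequality at time T gives γ ∑ ‖∇F(x_t)‖ ≤ 2Δ.

Rate. If γ ≥ cM, it remains to bound Δ/(MT), one term of the minimum M at a time
(`gap_le_stepScale_mul_rate`). The two exponents in α balance the terms of M that increase with α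
against those that decrease. -/

noncomputable section

namespace ClippedMVR

/-! ### Dimension-free estimates for cosh of the norm -/

section Cosh

variable {V : Type*} [NormedAddCommGroup V] [InnerProductSpace ℝ V]

lemma norm_add_sq_eq_combination {a b : V} {u : ℝ} (hu : inner ℝ a b = ‖a‖ * ‖b‖ * u) :
    ‖a + b‖ ^ 2 = (1 - u) / 2 * (‖a‖ - ‖b‖) ^ 2 + (1 + u) / 2 * (‖a‖ + ‖b‖) ^ 2 := by
  rw [norm_add_sq_real, hu]; ring

lemma exists_cosine (a b : V) :
    ∃ u : ℝ, -1 ≤ u ∧ u ≤ 1 ∧ inner ℝ a b = ‖a‖ * ‖b‖ * u := by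
  by_cases h : ‖a‖ * ‖b‖ = 0
  · refine ⟨0, by norm_num, by norm_num, ?_⟩
    have := abs_real_inner_le_norm a b
    rw [h] at this
    simpa using this
  · have h1 := abs_le.mp (abs_real_inner_div_norm_mul_norm_le_one a b)
    exact ⟨_, h1.1, h1.2, (mul_div_cancel₀ _ h).symm⟩

/-- Convexity of `s ↦ cosh √s`, applied between `(‖a‖ - ‖b‖)²` and `(‖a‖ + ‖b‖)²`. -/
lemma cosh_norm_add_le_of_inner_eq {a b : V} {u : ℝ} (h₁ : -1 ≤ u) (h₂ : u ≤ 1)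
    (hu : inner ℝ a b = ‖a‖ * ‖b‖ * u) :
    Real.cosh ‖a + b‖ ≤ Real.cosh ‖a‖ * Real.cosh ‖b‖ + u * (Real.sinh ‖a‖ * Real.sinh ‖b‖) := by
  have key : Real.cosh ‖a + b‖ ≤
      (1 - u) / 2 * Real.cosh (‖a‖ - ‖b‖) + (1 + u) / 2 * Real.cosh (‖a‖ + ‖b‖) := by
    -- The series of cosh contains only powers of the square, so convexity of s ↦ sⁿ on s ≥ 0 can be
    -- applied term by term.
    refine hasSum_le (fun n => ?_) (Real.hasSum_cosh ‖a + b‖)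
      (((Real.hasSum_cosh (‖a‖ - ‖b‖)).mul_left ((1 - u) / 2)).add
        ((Real.hasSum_cosh (‖a‖ + ‖b‖)).mul_left ((1 + u) / 2)))
    have hc := (convexOn_pow n : ConvexOn ℝ _ fun x : ℝ => x ^ n).2
      (Set.mem_Ici.2 (sq_nonneg (‖a‖ - ‖b‖)))
      (Set.mem_Ici.2 (sq_nonneg (‖a‖ + ‖b‖)))
      (by linarith : 0 ≤ (1 - u) / 2) (by linarith : 0 ≤ (1 + u) / 2) (by ring)
    simp only [smul_eq_mul] at hc
    rw [← norm_add_sq_eq_combination hu] at hc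
    simp only [pow_mul, mul_div_assoc', ← add_div]
    gcongr
  rw [Real.cosh_sub, Real.cosh_add] at key
  linarith

lemma sinh_le_cosh (x : ℝ) : Real.sinh x ≤ Real.cosh x := by
  have := Real.cosh_sub_sinh x
  have := Real.exp_pos (-x)
  linarith

/-- Second-order expansion of cosh‖·‖ at `a`. The inner product term is its derivative in direction
`b`, kept exact so that it vanishes for centred `b`; the rest is at most cosh‖a‖ (e^‖b‖ − ‖b‖). At
`a = 0` the quotient is 0 by convention, which is the correct derivative. -/
lemma cosh_norm_add_le (a : V) {b : V} (hb : ‖b‖ ≤ 1) :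
    Real.cosh ‖a + b‖ ≤
      Real.cosh ‖a‖ * (1 + ‖b‖ ^ 2) + Real.sinh ‖a‖ / ‖a‖ * inner ℝ a b := by
  obtain ⟨u, h₁, h₂, hu⟩ := exists_cosine a b
  have h := cosh_norm_add_le_of_inner_eq h₁ h₂ hu
  have hsa : 0 ≤ Real.sinh ‖a‖ := Real.sinh_nonneg_iff.2 (norm_nonneg a)
  have hsb : 0 ≤ Real.sinh ‖b‖ - ‖b‖ := sub_nonneg.2 (Real.self_le_sinh_iff.2 (norm_nonneg b))
  have hin : Real.sinh ‖a‖ / ‖a‖ * inner ℝ a b = u * (Real.sinh ‖a‖ * ‖b‖) := by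
    rw [hu]
    rcases eq_or_ne ‖a‖ 0 with h0 | h0
    · simp [h0]
    · field_simp
  have hexp : Real.cosh ‖b‖ + Real.sinh ‖b‖ - ‖b‖ ≤ 1 + ‖b‖ ^ 2 := by
    have h3 := (abs_le.mp (Real.abs_exp_sub_one_sub_id_le (x := ‖b‖) (by simpa using hb))).2
    rw [Real.cosh_add_sinh]
    linarith
  have h4 : u * (Real.sinh ‖a‖ * (Real.sinh ‖b‖ - ‖b‖)) ≤
      Real.cosh ‖a‖ * (Real.sinh ‖b‖ - ‖b‖) :=
    (mul_le_of_le_one_left (mul_nonneg hsa hsb) h₂).trans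
      (mul_le_mul_of_nonneg_right (sinh_le_cosh _) hsb)
  have h5 := mul_le_mul_of_nonneg_left hexp (Real.cosh_pos ‖a‖).le
  rw [hin]
  linarith

/-- Convexity of exp between 0 and ±y. It turns the factor 1 − α of the momentum recursion into a
contraction of cosh towards 1. -/
lemma cosh_mul_le {c : ℝ} (h₀ : 0 ≤ c) (h₁ : c ≤ 1) (y : ℝ) :
    Real.cosh (c * y) ≤ c * Real.cosh y + (1 - c) := by
  have h (z : ℝ) : Real.exp (c * z) ≤ c * Real.exp z + (1 - c) := by
    simpa using convexOn_exp.2 (Set.mem_univ z) (Set.mem_univ 0) h₀ (sub_nonneg.2 h₁) (by ring)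
  have h2 := h y
  have h3 := h (-y)
  rw [Real.cosh_eq, Real.cosh_eq, ← mul_neg]
  linarith

lemma integral_cosh_norm_add_le [CompleteSpace V] {Ξ : Type*} [MeasurableSpace Ξ]
    {D : Measure Ξ} [IsProbabilityMeasure D] (a : V) {k : Ξ → V} (hk : AEStronglyMeasurable k D)
    (hk₁ : ∀ s, ‖k s‖ ≤ 1) (hk₀ : ∫ s, k s ∂D = 0) {v : ℝ} (hv : ∫ s, ‖k s‖ ^ 2 ∂D ≤ v) :
    ∫ s, Real.cosh ‖a + k s‖ ∂D ≤ Real.cosh ‖a‖ * (1 + v) := by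
  have hki : Integrable k D := Integrable.of_bound hk 1 (ae_of_all _ hk₁)
  have hk2 : Integrable (fun s => ‖k s‖ ^ 2) D := by
    refine Integrable.of_bound (hk.norm.pow 2) 1 (ae_of_all _ fun s => ?_)
    rw [Real.norm_of_nonneg (by positivity)]
    exact pow_le_one₀ (norm_nonneg _) (hk₁ s)
  have hi1 : Integrable (fun s => Real.cosh ‖a‖ * (1 + ‖k s‖ ^ 2)) D :=
    ((integrable_const _).add hk2).const_mul _
  have hi2 : Integrable (fun s => Real.sinh ‖a‖ / ‖a‖ * inner ℝ a (k s)) D :=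
    (hki.const_inner a).const_mul _
  calc ∫ s, Real.cosh ‖a + k s‖ ∂D
      ≤ ∫ s, (Real.cosh ‖a‖ * (1 + ‖k s‖ ^ 2) + Real.sinh ‖a‖ / ‖a‖ * inner ℝ a (k s)) ∂D :=
        integral_mono_of_nonneg (ae_of_all _ fun s => (Real.cosh_pos _).le) (hi1.add hi2)
          (ae_of_all _ fun s => cosh_norm_add_le a (hk₁ s))
    _ = Real.cosh ‖a‖ * (1 + ∫ s, ‖k s‖ ^ 2 ∂D) := by
        rw [integral_add hi1 hi2, integral_const_mul, integral_const_mul, integral_inner hki,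
          hk₀, integral_add (integrable_const _) hk2]
        simp
    _ ≤ _ := by
        gcongr

end Cosh

/-! ### Clipping as projection onto a ball -/

section Clip

variable {d : ℕ}

lemma norm_clip_le (v : Pt d) {lam : ℝ} (hlam : 0 ≤ lam) : ‖clip v lam‖ ≤ lam := by
  rw [clip, norm_smul, Real.norm_of_nonneg (by positivity)]
  rcases eq_or_ne ‖v‖ 0 with h | h
  · simpa [h] using hlam
  · calc min 1 (lam / ‖v‖) * ‖v‖ ≤ lam / ‖v‖ * ‖v‖ := by gcongr; exact min_le_right _ _
      _ = lam := by field_simp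

lemma clip_of_norm_le {v : Pt d} {lam : ℝ} (h : ‖v‖ ≤ lam) : clip v lam = v := by
  rcases eq_or_ne v 0 with rfl | h0
  · simp [clip]
  · rw [clip, min_eq_left, one_smul]
    rwa [one_le_div (norm_pos_iff.2 h0)]

lemma norm_clip_sub_self (v : Pt d) {lam : ℝ} (hlam : 0 ≤ lam) (h : lam ≤ ‖v‖) :
    ‖clip v lam - v‖ = ‖v‖ - lam := by
  rcases eq_or_ne ‖v‖ 0 with h0 | h0
  · have : lam = 0 := by linarith
    simp [norm_eq_zero.1 h0, this, clip]
  · have hpos : 0 < ‖v‖ := by positivity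
    have h1 : lam / ‖v‖ ≤ 1 := (div_le_one hpos).2 h
    have h2 : clip v lam - v = (lam / ‖v‖ - 1) • v := by
      rw [clip, min_eq_right h1, sub_smul, one_smul]
    rw [h2, norm_smul, Real.norm_of_nonpos (by linarith)]
    field_simp
    ring

/-- Variational characterization of `clip v lam` as the projection of `v` to the ball. -/
lemma inner_sub_clip_nonpos (v : Pt d) {w : Pt d} {lam : ℝ} (hw : ‖w‖ ≤ lam) :
    inner ℝ (v - clip v lam) (w - clip v lam) ≤ 0 := by
  rcases le_total ‖v‖ lam with h | h
  · simp [clip_of_norm_le h]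
  rcases eq_or_ne ‖v‖ 0 with h0 | h0
  · simp [norm_eq_zero.1 h0, clip]
  have hpos : 0 < ‖v‖ := by positivity
  have h1 : lam / ‖v‖ ≤ 1 := (div_le_one hpos).2 h
  have h2 : v - clip v lam = (1 - lam / ‖v‖) • v := by
    rw [clip, min_eq_right h1, sub_smul, one_smul]
  rw [h2, clip, min_eq_right h1, real_inner_smul_left, inner_sub_right, real_inner_smul_right,
    real_inner_self_eq_norm_sq]
  refine mul_nonpos_of_nonneg_of_nonpos (by linarith) ?_
  have h3 : lam / ‖v‖ * ‖v‖ ^ 2 = ‖v‖ * lam := by field_simp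
  rw [h3]
  have := real_inner_le_norm v w
  have := mul_le_mul_of_nonneg_left hw hpos.le
  linarith

/-- Adding the variational inequalities at the two projections gives ‖a − b‖² ≤ ⟨v − w, a − b⟩;
Cauchy–Schwarz finishes. -/
lemma norm_clip_sub_clip_le (v w : Pt d) {lam : ℝ} (hlam : 0 ≤ lam) :
    ‖clip v lam - clip w lam‖ ≤ ‖v - w‖ := by
  set a := clip v lam
  set b := clip w lam
  have h1 : inner ℝ (v - a) (b - a) ≤ 0 := inner_sub_clip_nonpos v (norm_clip_le w hlam)
  have h2 : inner ℝ (w - b) (a - b) ≤ 0 := inner_sub_clip_nonpos w (norm_clip_le v hlam)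
  have h3 : ‖a - b‖ ^ 2 ≤ inner ℝ (v - w) (a - b) := by
    have e : inner ℝ (v - w) (a - b) =
        ‖a - b‖ ^ 2 - inner ℝ (v - a) (b - a) - inner ℝ (w - b) (a - b) := by
      rw [← real_inner_self_eq_norm_sq, ← neg_sub a b, inner_neg_right, sub_neg_eq_add,
        ← inner_add_left, ← inner_sub_left]
      congr 1
      abel
    linarith
  have h4 := real_inner_le_norm (v - w) (a - b)
  by_contra! hc
  have := norm_nonneg (v - w)
  nlinarith

lemma measurable_clip (lam : ℝ) : Measurable fun v : Pt d => clip v lam := by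
  unfold clip
  fun_prop

end Clip

/-! ### Variance and bias of a clipped heavy-tailed vector -/

section ClipMoments

variable {d : ℕ} {Ξ : Type*} [MeasurableSpace Ξ] {D : Measure Ξ}

/-- Interpolation: the clipped difference x satisfies both x ≤ 2λ and x ≤ ‖Y − m‖, so x² = x^(2−p)
x^p is controlled by the p-th moment. Comparing with the clipped `m` avoids any assumption on the
size of `m`. -/
lemma integral_sq_norm_clip_sub_clip_le {Y : Ξ → Pt d} {m : Pt d} {α lam p : ℝ} (hlam : 0 < lam)
    (hp₁ : 1 ≤ p) (hp₂ : p ≤ 2) (hi : Integrable (fun s => ‖Y s - m‖ ^ p) D)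
    (h : ∫ s, ‖Y s - m‖ ^ p ∂D ≤ α * lam ^ p) :
    ∫ s, ‖clip (Y s) lam - clip m lam‖ ^ 2 ∂D ≤ 2 * α * lam ^ 2 := by
  have hα : 0 ≤ α := by
    have h0 : 0 ≤ ∫ s, ‖Y s - m‖ ^ p ∂D := integral_nonneg fun s => by positivity
    exact nonneg_of_mul_nonneg_left (h0.trans h) (by positivity)
  have hpt (s : Ξ) : ‖clip (Y s) lam - clip m lam‖ ^ 2 ≤ (2 * lam) ^ (2 - p) * ‖Y s - m‖ ^ p := by
    set x := ‖clip (Y s) lam - clip m lam‖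
    have hx : 0 ≤ x := norm_nonneg _
    have h1 : x ≤ ‖Y s - m‖ := norm_clip_sub_clip_le _ _ hlam.le
    have h2 : x ≤ 2 * lam := by
      have := norm_sub_le (clip (Y s) lam) (clip m lam)
      have := norm_clip_le (Y s) hlam.le
      have := norm_clip_le m hlam.le
      linarith
    calc x ^ 2 = x ^ (2 - p) * x ^ p := by
          rw [← Real.rpow_add_of_nonneg hx (by linarith) (by linarith), sub_add_cancel,
            Real.rpow_two]
      _ ≤ _ := by gcongr
  calc ∫ s, ‖clip (Y s) lam - clip m lam‖ ^ 2 ∂D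
      ≤ ∫ s, (2 * lam) ^ (2 - p) * ‖Y s - m‖ ^ p ∂D :=
        integral_mono_of_nonneg (ae_of_all _ fun s => by positivity) (hi.const_mul _)
          (ae_of_all _ hpt)
    _ ≤ (2 * lam) ^ (2 - p) * (α * lam ^ p) := by
        rw [integral_const_mul]; gcongr
    _ = 2 ^ (2 - p) * (α * lam ^ 2) := by
        rw [Real.mul_rpow (by norm_num) hlam.le, ← Real.rpow_two lam,
          show (2 : ℝ) = (2 - p) + p by ring, Real.rpow_add hlam]
        ring_nf
    _ ≤ 2 ^ (1 : ℝ) * (α * lam ^ 2) := by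
        gcongr
        · norm_num
        · linarith
    _ = _ := by rw [Real.rpow_one]; ring

/-- Clipping changes Y only where ‖Y‖ > λ. There ‖m‖ ≤ λ/2 forces ‖Y − m‖ ≥ λ/2, so the change, at
most ‖Y − m‖, is at most (λ/2)^(1−p) ‖Y − m‖^p. -/
lemma norm_integral_clip_sub_le [IsProbabilityMeasure D] {Y : Ξ → Pt d} {m : Pt d}
    {α lam p : ℝ} (hlam : 0 < lam)
    (hp₁ : 1 ≤ p) (hp₂ : p ≤ 2) (hY : Integrable Y D) (hm : ∫ s, Y s ∂D = m)
    (hmlam : ‖m‖ ≤ lam / 2) (hi : Integrable (fun s => ‖Y s - m‖ ^ p) D)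
    (h : ∫ s, ‖Y s - m‖ ^ p ∂D ≤ α * lam ^ p) :
    ‖(∫ s, clip (Y s) lam ∂D) - m‖ ≤ 2 * α * lam := by
  have hα : 0 ≤ α := by
    have h0 : 0 ≤ ∫ s, ‖Y s - m‖ ^ p ∂D := integral_nonneg fun s => by positivity
    exact nonneg_of_mul_nonneg_left (h0.trans h) (by positivity)
  have hc : Integrable (fun s => clip (Y s) lam) D :=
    Integrable.of_bound ((measurable_clip lam).comp_aemeasurable
      hY.aestronglyMeasurable.aemeasurable).aestronglyMeasurable lam
      (ae_of_all _ fun s => norm_clip_le _ hlam.le)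
  have hpt (s : Ξ) : ‖clip (Y s) lam - Y s‖ ≤ (lam / 2) ^ (1 - p) * ‖Y s - m‖ ^ p := by
    rcases le_total ‖Y s‖ lam with hle | hle
    · rw [clip_of_norm_le hle, sub_self, norm_zero]
      positivity
    · rw [norm_clip_sub_self _ hlam.le hle]
      have h1 := norm_sub_norm_le (Y s) m
      have h2 : lam / 2 ≤ ‖Y s - m‖ := by linarith
      have h3 : 0 < ‖Y s - m‖ := by linarith
      calc ‖Y s‖ - lam ≤ ‖Y s - m‖ := by linarith
        _ = ‖Y s - m‖ ^ (1 - p) * ‖Y s - m‖ ^ p := by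
            rw [← Real.rpow_add h3, sub_add_cancel, Real.rpow_one]
        _ ≤ _ := mul_le_mul_of_nonneg_right
            (Real.rpow_le_rpow_of_nonpos (by linarith) h2 (by linarith)) (by positivity)
  calc ‖(∫ s, clip (Y s) lam ∂D) - m‖ = ‖∫ s, (clip (Y s) lam - Y s) ∂D‖ := by
        rw [integral_sub hc hY, hm]
    _ ≤ ∫ s, ‖clip (Y s) lam - Y s‖ ∂D := norm_integral_le_integral_norm _
    _ ≤ ∫ s, (lam / 2) ^ (1 - p) * ‖Y s - m‖ ^ p ∂D :=
        integral_mono_of_nonneg (ae_of_all _ fun s => norm_nonneg _) (hi.const_mul _)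
          (ae_of_all _ hpt)
    _ ≤ (lam / 2) ^ (1 - p) * (α * lam ^ p) := by
        rw [integral_const_mul]; gcongr
    _ = 2 ^ (p - 1) * (α * lam) := by
        rw [Real.div_rpow hlam.le (by norm_num), ← neg_sub p 1, Real.rpow_neg (by norm_num : (0:ℝ) ≤ 2),
          Real.rpow_neg hlam.le, Real.rpow_sub_one hlam.ne']
        have := (Real.rpow_pos_of_pos hlam p).ne'
        field_simp
    _ ≤ 2 ^ (1 : ℝ) * (α * lam) := by
        gcongr
        · norm_num
        · linarith
    _ = _ := by rw [Real.rpow_one]; ring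

end ClipMoments

/-! ### Exponential moments and tails of contracted martingale sums -/

section Chain

variable {Ω Ξ : Type*} [mΞ : MeasurableSpace Ξ]

/-- The σ-algebra generated by `ξ 0, …, ξ t`. -/
@[reducible] def past (ξ : ℕ → Ω → Ξ) (t : ℕ) : MeasurableSpace Ω :=
  ⨆ i ∈ Set.Iic t, mΞ.comap (ξ i)

lemma past_mono (ξ : ℕ → Ω → Ξ) : Monotone (past ξ) := fun _ _ h =>
  biSup_mono fun _ hi => le_trans hi h

lemma measurable_past (ξ : ℕ → Ω → Ξ) (t : ℕ) : Measurable[past ξ t] (ξ t) :=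
  measurable_iff_comap_le.2 (le_iSup₂_of_le t (Set.mem_Iic.2 le_rfl) le_rfl)

variable [MeasurableSpace Ω]

lemma past_le {ξ : ℕ → Ω → Ξ} (hξ : ∀ t, Measurable (ξ t)) (t : ℕ) :
    past ξ t ≤ ‹MeasurableSpace Ω› :=
  iSup₂_le fun i _ => (hξ i).comap_le

lemma IIDSamples.indepFun_of_past {μ : Measure Ω} {D : Measure Ξ} {ξ : ℕ → Ω → Ξ}
    (hξ : IIDSamples μ D ξ) {β : Type*} [MeasurableSpace β] {t : ℕ} {U : Ω → β}
    (hU : Measurable[past ξ t] U) : IndepFun U (ξ (t + 1)) μ := by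
  have h := indep_iSup_of_disjoint (fun i => (hξ.1 i).comap_le) hξ.2.1.iIndep
    (S := Set.Iic t) (T := {t + 1}) (by simp)
  rw [iSup_singleton] at h
  exact (IndepFun_iff_Indep _ _ _).2 (indep_of_indep_of_le_left h (measurable_iff_comap_le.1 hU))

/-- Freezing lemma: the new sample is independent of the past, so the joint law is a product and
Fubini applies. It replaces conditional expectations. -/
lemma IIDSamples.integral_past {μ : Measure Ω} [IsProbabilityMeasure μ] {D : Measure Ξ}
    [IsProbabilityMeasure D] {ξ : ℕ → Ω → Ξ}
    (hξ : IIDSamples μ D ξ) {β : Type*} [MeasurableSpace β] {t : ℕ} {U : Ω → β}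
    (hU : Measurable[past ξ t] U) {f : β → Ξ → ℝ} (hf : Measurable (Function.uncurry f))
    (hi : Integrable (fun ω => f (U ω) (ξ (t + 1) ω)) μ) :
    Integrable (fun ω => ∫ s, f (U ω) s ∂D) μ ∧
      ∫ ω, f (U ω) (ξ (t + 1) ω) ∂μ = ∫ ω, ∫ s, f (U ω) s ∂D ∂μ := by
  have hUm : Measurable U := hU.mono (past_le hξ.1 t) le_rfl
  have hmap := (indepFun_iff_map_prod_eq_prod_map_map hUm.aemeasurable
    (hξ.1 (t + 1)).aemeasurable).1 (hξ.indepFun_of_past hU)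
  rw [hξ.2.2] at hmap
  have : IsProbabilityMeasure (μ.map U) := Measure.isProbabilityMeasure_map hUm.aemeasurable
  have hpair : AEMeasurable (fun ω => (U ω, ξ (t + 1) ω)) μ :=
    (hUm.prodMk (hξ.1 (t + 1))).aemeasurable
  have hi' : Integrable (Function.uncurry f) ((μ.map U).prod D) := by
    rw [← hmap]
    exact (integrable_map_measure hf.aestronglyMeasurable hpair).2 hi
  have hin := hi'.integral_prod_left
  refine ⟨(integrable_map_measure hin.aestronglyMeasurable hUm.aemeasurable).1 hin, ?_⟩
  calc ∫ ω, f (U ω) (ξ (t + 1) ω) ∂μ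
      = ∫ z, Function.uncurry f z ∂(μ.map fun ω => (U ω, ξ (t + 1) ω)) :=
        (integral_map hpair hf.aestronglyMeasurable).symm
    _ = ∫ u, ∫ s, f u s ∂D ∂(μ.map U) := by
        rw [hmap, integral_prod _ hi']; rfl
    _ = _ := integral_map hUm.aemeasurable hin.aestronglyMeasurable

/-- An exponentially weighted sum of bounded martingale differences with conditional second
moments at most `α / 2` has a bounded exponential moment. -/
lemma IIDSamples.integral_cosh_le {μ : Measure Ω} [IsProbabilityMeasure μ] {D : Measure Ξ}
    [IsProbabilityMeasure D] {ξ : ℕ → Ω → Ξ} (hξ : IIDSamples μ D ξ)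
    {d : ℕ} {β : Type*} [MeasurableSpace β] {S : ℕ → Ω → Pt d} {U : ℕ → Ω → β}
    {k : β → Ξ → Pt d} {α : ℝ} (hα₀ : 0 ≤ α) (hα₁ : α ≤ 1)
    (hk : Measurable (Function.uncurry k)) (hU : ∀ t, Measurable[past ξ t] (U t))
    (hS₀ : ∀ ω, S 0 ω = 0)
    (hS : ∀ t ω, S (t + 1) ω = (1 - α) • S t ω + k (U t ω) (ξ (t + 1) ω))
    (hk₁ : ∀ t ω s, ‖k (U t ω) s‖ ≤ 1) (hk₀ : ∀ t ω, ∫ s, k (U t ω) s ∂D = 0)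
    (hk₂ : ∀ t ω, ∫ s, ‖k (U t ω) s‖ ^ 2 ∂D ≤ α / 2) (t : ℕ) :
    Integrable (fun ω => Real.cosh ‖S t ω‖) μ ∧ ∫ ω, Real.cosh ‖S t ω‖ ∂μ ≤ 3 := by
  have hSm (t : ℕ) : Measurable[past ξ t] (S t) := by
    induction t with
    | zero => rw [show S 0 = fun _ => 0 from funext hS₀]; exact measurable_const
    | succ t ih =>
      rw [show S (t + 1) = _ from funext (hS t)]
      have h1 : Measurable[past ξ (t + 1)] (S t) := ih.mono (past_mono ξ t.le_succ) le_rfl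
      have h2 : Measurable[past ξ (t + 1)] (U t) := (hU t).mono (past_mono ξ t.le_succ) le_rfl
      exact (h1.const_smul (1 - α)).add (hk.comp (h2.prodMk (measurable_past ξ (t + 1))))
  -- This crude bound serves only for integrability.
  have hSb (t : ℕ) (ω : Ω) : ‖S t ω‖ ≤ t := by
    induction t with
    | zero => simp [hS₀]
    | succ t ih =>
      rw [hS]
      calc _ ≤ ‖(1 - α) • S t ω‖ + ‖k (U t ω) (ξ (t + 1) ω)‖ := norm_add_le _ _
        _ ≤ 1 * t + 1 := by
          refine add_le_add ?_ (hk₁ _ _ _)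
          rw [norm_smul, Real.norm_of_nonneg (by linarith)]
          exact mul_le_mul (by linarith) ih (norm_nonneg _) zero_le_one
        _ = _ := by push_cast; ring
  have hint (t : ℕ) : Integrable (fun ω => Real.cosh ‖S t ω‖) μ := by
    have hm : Measurable fun ω => Real.cosh ‖S t ω‖ :=
      Real.measurable_cosh.comp ((hSm t).mono (past_le hξ.1 t) le_rfl).norm
    refine Integrable.of_bound hm.aestronglyMeasurable (Real.cosh t) (ae_of_all _ fun ω => ?_)
    rw [Real.norm_of_nonneg (Real.cosh_pos _).le, Real.cosh_le_cosh, abs_norm, Nat.abs_cast]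
    exact hSb t ω
  refine ⟨hint t, ?_⟩
  induction t with
  | zero => simp [hS₀]
  | succ t ih =>
    have hi := hint (t + 1)
    simp only [hS t] at hi ⊢
    have hf : Measurable fun z : (Pt d × β) × Ξ => Real.cosh ‖(1 - α) • z.1.1 + k z.1.2 z.2‖ :=
      Real.measurable_cosh.comp ((measurable_fst.fst.const_smul (1 - α)).add
        (hk.comp (measurable_fst.snd.prodMk measurable_snd))).norm
    have hpair : Measurable[past ξ t] fun ω => (S t ω, U t ω) := (hSm t).prodMk (hU t)
    obtain ⟨hi1, heq⟩ := hξ.integral_past (t := t) (U := fun ω => (S t ω, U t ω))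
      (f := fun u s => Real.cosh ‖(1 - α) • u.1 + k u.2 s‖) hpair hf hi
    dsimp only at hi1 heq
    rw [heq]
    have hpt (ω : Ω) : ∫ s, Real.cosh ‖(1 - α) • S t ω + k (U t ω) s‖ ∂D ≤
        ((1 - α) * Real.cosh ‖S t ω‖ + α) * (1 + α / 2) := by
      refine (integral_cosh_norm_add_le _
        (hk.comp (measurable_const.prodMk measurable_id)).aestronglyMeasurable (hk₁ t ω)
        (hk₀ t ω) (hk₂ t ω)).trans ?_
      gcongr
      rw [norm_smul, Real.norm_of_nonneg (by linarith)]
      have := cosh_mul_le (c := 1 - α) (by linarith) (by linarith) ‖S t ω‖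
      linarith
    have hi2 : Integrable (fun ω => ((1 - α) * Real.cosh ‖S t ω‖ + α) * (1 + α / 2)) μ :=
      (((hint t).const_mul _).add (integrable_const _)).mul_const _
    calc _ ≤ ∫ ω, ((1 - α) * Real.cosh ‖S t ω‖ + α) * (1 + α / 2) ∂μ :=
          integral_mono hi1 hi2 hpt
      _ = ((1 - α) * (∫ ω, Real.cosh ‖S t ω‖ ∂μ) + α) * (1 + α / 2) := by
          rw [integral_mul_const, integral_add ((hint t).const_mul _) (integrable_const _),
            integral_const_mul]
          simp
      _ ≤ ((1 - α) * 3 + α) * (1 + α / 2) := by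
          gcongr
      -- The product is 3 − α/2 − α²: the level 3 is preserved by the recursion.
      _ ≤ 3 := by nlinarith

lemma le_measureReal_forall_norm_le {μ : Measure Ω} [IsProbabilityMeasure μ] {d : ℕ}
    {S : ℕ → Ω → Pt d} {T : ℕ} {β : ℝ} (hT : 1 ≤ T) (hβ : 0 < β)
    (hi : ∀ t, Integrable (fun ω => Real.cosh ‖S t ω‖) μ)
    (hS : ∀ t, ∫ ω, Real.cosh ‖S t ω‖ ∂μ ≤ 3) :
    1 - β ≤ μ.real {ω | ∀ t < T, ‖S t ω‖ ≤ Real.log (8 * T / β)} := by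
  have hT' : (0 : ℝ) < T := by positivity
  set Z : Ω → ℝ := fun ω => ∑ t ∈ Finset.range T, Real.cosh ‖S t ω‖
  have hZi : Integrable Z μ := integrable_finsetSum _ fun t _ => hi t
  have hZ : ∫ ω, Z ω ∂μ ≤ 3 * T := by
    rw [integral_finsetSum _ fun t _ => hi t]
    calc _ ≤ ∑ t ∈ Finset.range T, (3 : ℝ) := Finset.sum_le_sum fun t _ => hS t
      _ = _ := by simp; ring
  -- Markov for the sum over time bounds all T terms at once, since each cosh is at most the sum.
  have hmarkov := mul_meas_ge_le_integral_of_nonneg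
    (ae_of_all μ fun ω => Finset.sum_nonneg fun t _ => (Real.cosh_pos ‖S t ω‖).le) hZi (3 * T / β)
  have hle : μ.real {ω | 3 * T / β ≤ Z ω} ≤ β := by
    have h : 3 * T / β * μ.real {ω | 3 * T / β ≤ Z ω} ≤ 3 * T / β * β := by
      rw [div_mul_cancel₀ _ hβ.ne']
      exact hmarkov.trans hZ
    exact le_of_mul_le_mul_left h (by positivity)
  have hsub : {ω | 3 * T / β ≤ Z ω}ᶜ ⊆ {ω | ∀ t < T, ‖S t ω‖ ≤ Real.log (8 * T / β)} := by
    intro ω hω t ht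
    have h1 : Real.cosh ‖S t ω‖ < 3 * T / β :=
      (Finset.single_le_sum (f := fun t => Real.cosh ‖S t ω‖)
        (fun t _ => (Real.cosh_pos ‖S t ω‖).le) (Finset.mem_range.2 ht)).trans_lt (not_le.1 hω)
    rw [Real.le_log_iff_exp_le (by positivity)]
    have h2 : Real.exp ‖S t ω‖ ≤ 2 * Real.cosh ‖S t ω‖ := by
      rw [Real.cosh_eq]
      have := Real.exp_pos (-‖S t ω‖)
      linarith
    -- exp ≤ 2 cosh gives 6T/β; the constant 8 leaves slack.
    have h3 : 2 * (3 * T / β) ≤ 8 * T / β := by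
      rw [← mul_div_assoc]
      exact div_le_div_of_nonneg_right (by linarith) hβ.le
    linarith
  have hnull : NullMeasurableSet {ω | 3 * T / β ≤ Z ω} μ :=
    nullMeasurableSet_le aemeasurable_const hZi.aestronglyMeasurable.aemeasurable
  calc 1 - β ≤ 1 - μ.real {ω | 3 * T / β ≤ Z ω} := by linarith
    _ = μ.real {ω | 3 * T / β ≤ Z ω}ᶜ := (probReal_compl_eq_one_sub₀ hnull).symm
    _ ≤ _ := measureReal_mono hsub

end Chain

/-! ### Conditional mean and variance of the update direction -/

section Direction

variable {d : ℕ} {Ξ : Type*}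

/-- The stochastic part of the momentum update at the pair of points `z = (x_t, x_{t-1})`. -/
def direction (G : Pt d → Ξ → Pt d) (α lam₁ lam₂ : ℝ) (z : Pt d × Pt d) (s : Ξ) : Pt d :=
  (1 - α) • clip (G z.1 s - G z.2 s) lam₁ + α • clip (G z.1 s) lam₂

/-- The conditional mean of `direction`. -/
def meanDirection [MeasurableSpace Ξ] (D : Measure Ξ) (G : Pt d → Ξ → Pt d) (α lam₁ lam₂ : ℝ)
    (z : Pt d × Pt d) : Pt d :=
  ∫ s, direction G α lam₁ lam₂ z s ∂D

lemma norm_direction_le (G : Pt d → Ξ → Pt d) {α lam₁ lam₂ : ℝ} (hα₀ : 0 ≤ α) (hα₁ : α ≤ 1)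
    (h₁ : 0 ≤ lam₁) (h₂ : 0 ≤ lam₂) (z : Pt d × Pt d) (s : Ξ) :
    ‖direction G α lam₁ lam₂ z s‖ ≤ lam₁ + α * lam₂ := by
  refine (norm_add_le _ _).trans ?_
  rw [norm_smul, norm_smul, Real.norm_of_nonneg (by linarith), Real.norm_of_nonneg hα₀]
  have h3 := norm_clip_le (G z.1 s - G z.2 s) h₁
  have h4 := norm_clip_le (G z.1 s) h₂
  refine add_le_add ?_ (by gcongr)
  exact (mul_le_of_le_one_left (norm_nonneg _) (by linarith)).trans h3

lemma sq_norm_combination_le {α : ℝ} (hα₀ : 0 ≤ α) (hα₁ : α ≤ 1) (a b : Pt d) :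
    ‖(1 - α) • a + α • b‖ ^ 2 ≤ 2 * ‖a‖ ^ 2 + 2 * α ^ 2 * ‖b‖ ^ 2 := by
  have h : ‖(1 - α) • a + α • b‖ ≤ ‖a‖ + α * ‖b‖ := by
    refine (norm_add_le _ _).trans ?_
    rw [norm_smul, norm_smul, Real.norm_of_nonneg (by linarith), Real.norm_of_nonneg hα₀]
    exact add_le_add_left (mul_le_of_le_one_left (norm_nonneg _) (by linarith)) _
  have := sq_nonneg (‖a‖ - α * ‖b‖)
  calc _ ≤ (‖a‖ + α * ‖b‖) ^ 2 := by gcongr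
    _ ≤ _ := by linarith

variable [MeasurableSpace Ξ]

lemma measurable_direction {Ω : Type*} [MeasurableSpace Ω] {G : Pt d → Ξ → Pt d}
    (hG : Measurable (Function.uncurry G)) (α lam₁ lam₂ : ℝ) {f : Ω → Pt d × Pt d} {g : Ω → Ξ}
    (hf : Measurable f) (hg : Measurable g) :
    Measurable fun w => direction G α lam₁ lam₂ (f w) (g w) := by
  have h1 : Measurable fun w => G (f w).1 (g w) := hG.comp (hf.fst.prodMk hg)
  have h2 : Measurable fun w => G (f w).2 (g w) := hG.comp (hf.snd.prodMk hg)
  have h3 : Measurable fun w => clip (G (f w).1 (g w) - G (f w).2 (g w)) lam₁ :=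
    (measurable_clip lam₁).comp (h1.sub h2)
  have h4 : Measurable fun w => clip (G (f w).1 (g w)) lam₂ := (measurable_clip lam₂).comp h1
  exact (h3.const_smul (1 - α)).add (h4.const_smul α)

lemma measurable_meanDirection {D : Measure Ξ} [SFinite D] {G : Pt d → Ξ → Pt d}
    (hG : Measurable (Function.uncurry G)) (α lam₁ lam₂ : ℝ) :
    Measurable (meanDirection D G α lam₁ lam₂) := by
  have h : Measurable fun w : (Pt d × Pt d) × Ξ => direction G α lam₁ lam₂ w.1 w.2 :=
    measurable_direction hG α lam₁ lam₂ measurable_fst measurable_snd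
  exact h.stronglyMeasurable.integral_prod_right.measurable

/-- The mean minimizes the mean square distance, so the centre may be replaced by any convenient
point, later a combination of clipped gradients. -/
lemma integral_sq_norm_sub_integral_le {D : Measure Ξ} [IsProbabilityMeasure D] {X : Ξ → Pt d}
    {b : ℝ} (hX : AEStronglyMeasurable X D) (hb : ∀ s, ‖X s‖ ≤ b) (c : Pt d) :
    ∫ s, ‖X s - ∫ s', X s' ∂D‖ ^ 2 ∂D ≤ ∫ s, ‖X s - c‖ ^ 2 ∂D := by
  set m := ∫ s', X s' ∂D
  have hXi : Integrable X D := Integrable.of_bound hX b (ae_of_all _ hb)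
  have hc : Integrable (fun s => ‖X s - c‖ ^ 2) D := by
    refine Integrable.of_bound ((hX.sub aestronglyMeasurable_const).norm.pow 2) ((b + ‖c‖) ^ 2)
      (ae_of_all _ fun s => ?_)
    rw [Real.norm_of_nonneg (by positivity)]
    have := norm_sub_le (X s) c
    have := hb s
    gcongr
    linarith
  have hXm : Integrable (fun s => X s - m) D := hXi.sub (integrable_const m)
  have hi : Integrable (fun s => 2 * inner ℝ (c - m) (X s - m)) D :=
    (hXm.const_inner (c - m)).const_mul 2
  have h0 : ∫ s, 2 * inner ℝ (c - m) (X s - m) ∂D = 0 := by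
    rw [integral_const_mul, integral_inner hXm,
      integral_sub hXi (integrable_const m)]
    simp [m]
  calc ∫ s, ‖X s - m‖ ^ 2 ∂D ≤ ∫ s, (‖X s - c‖ ^ 2 + 2 * inner ℝ (c - m) (X s - m)) ∂D := by
        refine integral_mono_of_nonneg (ae_of_all _ fun s => by positivity) (hc.add hi)
          (ae_of_all _ fun s => ?_)
        have e : X s - c = (X s - m) - (c - m) := by abel
        have h := norm_sub_sq_real (X s - m) (c - m)
        rw [← e, real_inner_comm] at h
        have := sq_nonneg ‖c - m‖
        dsimp only
        linarith
    _ = _ := by rw [integral_add hc hi, h0, add_zero]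

/-- Moment bounds of the oracle relative to the clipping thresholds, on the set of pairs of points
at distance at most `γ`. -/
structure NoiseLevel (D : Measure Ξ) (F : Pt d → ℝ) (G : Pt d → Ξ → Pt d)
    (p q α lam₁ lam₂ γ : ℝ) : Prop where
  integrable : ∀ x, Integrable (G x) D
  integral_eq : ∀ x, ∫ s, G x s ∂D = gradient F x
  integrable_rpow : ∀ x, Integrable (fun s => ‖G x s - gradient F x‖ ^ p) D
  integral_rpow_le : ∀ x, ∫ s, ‖G x s - gradient F x‖ ^ p ∂D ≤ α * lam₂ ^ p
  integrable_diff_rpow : ∀ x y,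
    Integrable (fun s => ‖(G x s - G y s) - (gradient F x - gradient F y)‖ ^ q) D
  integral_diff_rpow_le : ∀ x y, ‖x - y‖ ≤ γ →
    ∫ s, ‖(G x s - G y s) - (gradient F x - gradient F y)‖ ^ q ∂D ≤ α * lam₁ ^ q

variable {D : Measure Ξ} [IsProbabilityMeasure D] {F : Pt d → ℝ} {G : Pt d → Ξ → Pt d}
  {p q α lam₁ lam₂ γ : ℝ}

lemma integrable_sq_norm_clip_sub_clip {D : Measure Ξ} [IsProbabilityMeasure D] {Y : Ξ → Pt d}
    (hY : Measurable Y) {lam : ℝ} (hlam : 0 ≤ lam) (m : Pt d) :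
    Integrable (fun s => ‖clip (Y s) lam - clip m lam‖ ^ 2) D := by
  have hm : Measurable fun s => clip (Y s) lam := (measurable_clip lam).comp hY
  refine Integrable.of_bound ((hm.sub_const _).norm.pow_const 2).aestronglyMeasurable
    ((lam + lam) ^ 2) (ae_of_all _ fun s => ?_)
  rw [Real.norm_of_nonneg (by positivity)]
  have := norm_sub_le (clip (Y s) lam) (clip m lam)
  have := norm_clip_le (Y s) hlam
  have := norm_clip_le m hlam
  gcongr
  linarith

lemma integrable_clip {D : Measure Ξ} [IsProbabilityMeasure D] {Y : Ξ → Pt d}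
    (hY : Measurable Y) {lam : ℝ} (hlam : 0 ≤ lam) : Integrable (fun s => clip (Y s) lam) D :=
  Integrable.of_bound ((measurable_clip lam).comp hY).aestronglyMeasurable lam
    (ae_of_all _ fun _ => norm_clip_le _ hlam)

lemma NoiseLevel.integral_sq_norm_le (h : NoiseLevel D F G p q α lam₁ lam₂ γ)
    (hG : Measurable (Function.uncurry G)) (hp₁ : 1 ≤ p) (hp₂ : p ≤ 2) (hq₁ : 1 ≤ q) (hq₂ : q ≤ 2)
    (hα₀ : 0 ≤ α) (hα₁ : α ≤ 1) (h₁ : 0 < lam₁) (h₂ : 0 < lam₂) {z : Pt d × Pt d}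
    (hz : ‖z.1 - z.2‖ ≤ γ) :
    ∫ s, ‖direction G α lam₁ lam₂ z s - meanDirection D G α lam₁ lam₂ z‖ ^ 2 ∂D ≤
      4 * α * (lam₁ + α * lam₂) ^ 2 := by
  set m₁ := gradient F z.1 - gradient F z.2
  set m₂ := gradient F z.1
  set c := (1 - α) • clip m₁ lam₁ + α • clip m₂ lam₂
  have hdir : Measurable (direction G α lam₁ lam₂ z) :=
    measurable_direction hG α lam₁ lam₂ measurable_const measurable_id
  have hGx (x : Pt d) : Measurable (G x) := hG.comp (measurable_const.prodMk measurable_id)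
  have i₁ := integral_sq_norm_clip_sub_clip_le h₁ hq₁ hq₂ (h.integrable_diff_rpow z.1 z.2)
    (h.integral_diff_rpow_le _ _ hz)
  have i₂ := integral_sq_norm_clip_sub_clip_le h₂ hp₁ hp₂ (h.integrable_rpow z.1)
    (h.integral_rpow_le z.1)
  have hd : Measurable fun s => G z.1 s - G z.2 s := (hGx z.1).sub (hGx z.2)
  have hi₁ := (integrable_sq_norm_clip_sub_clip (D := D) hd h₁.le m₁).const_mul 2
  have hi₂ := (integrable_sq_norm_clip_sub_clip (D := D) (hGx z.1) h₂.le m₂).const_mul (2 * α ^ 2)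
  refine (integral_sq_norm_sub_integral_le hdir.aestronglyMeasurable
    (norm_direction_le G hα₀ hα₁ h₁.le h₂.le z) c).trans ?_
  calc ∫ s, ‖direction G α lam₁ lam₂ z s - c‖ ^ 2 ∂D
      ≤ ∫ s, (2 * ‖clip (G z.1 s - G z.2 s) lam₁ - clip m₁ lam₁‖ ^ 2 +
          2 * α ^ 2 * ‖clip (G z.1 s) lam₂ - clip m₂ lam₂‖ ^ 2) ∂D := by
        refine integral_mono_of_nonneg (ae_of_all _ fun s => by positivity) (hi₁.add hi₂)
          (ae_of_all _ fun s => ?_)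
        have e : direction G α lam₁ lam₂ z s - c =
            (1 - α) • (clip (G z.1 s - G z.2 s) lam₁ - clip m₁ lam₁) +
              α • (clip (G z.1 s) lam₂ - clip m₂ lam₂) := by
          simp only [direction, c, smul_sub]; abel
        dsimp only
        rw [e]
        exact sq_norm_combination_le hα₀ hα₁ _ _
    _ ≤ 2 * (2 * α * lam₁ ^ 2) + 2 * α ^ 2 * (2 * α * lam₂ ^ 2) := by
        rw [integral_add hi₁ hi₂, integral_const_mul, integral_const_mul]
        gcongr
    _ ≤ _ := by
        have : 0 ≤ α * (lam₁ * (α * lam₂)) := by positivity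
        linarith

/-- The subtracted target equals ∇F(x_{t+1}) − (1 − α)∇F(x_t), so this is the drift of the momentum
error in one step. Unlike the variance bound, it needs small gradients. -/
lemma NoiseLevel.norm_meanDirection_sub_le (h : NoiseLevel D F G p q α lam₁ lam₂ γ)
    (hG : Measurable (Function.uncurry G)) (hp₁ : 1 ≤ p) (hp₂ : p ≤ 2) (hq₁ : 1 ≤ q) (hq₂ : q ≤ 2)
    (hα₀ : 0 ≤ α) (hα₁ : α ≤ 1) (h₁ : 0 < lam₁) (h₂ : 0 < lam₂) {z : Pt d × Pt d}
    (hz : ‖z.1 - z.2‖ ≤ γ) (hz₁ : ‖gradient F z.1 - gradient F z.2‖ ≤ lam₁ / 2)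
    (hz₂ : ‖gradient F z.1‖ ≤ lam₂ / 2) :
    ‖meanDirection D G α lam₁ lam₂ z -
        ((1 - α) • (gradient F z.1 - gradient F z.2) + α • gradient F z.1)‖ ≤
      2 * α * (lam₁ + α * lam₂) := by
  have hGx (x : Pt d) : Measurable (G x) := hG.comp (measurable_const.prodMk measurable_id)
  have hd : Measurable fun s => G z.1 s - G z.2 s := (hGx z.1).sub (hGx z.2)
  have hdi : Integrable (fun s => G z.1 s - G z.2 s) D := (h.integrable z.1).sub (h.integrable z.2)
  have b₁ := norm_integral_clip_sub_le h₁ hq₁ hq₂ hdi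
    (by rw [integral_sub (h.integrable z.1) (h.integrable z.2), h.integral_eq, h.integral_eq])
    hz₁ (h.integrable_diff_rpow z.1 z.2) (h.integral_diff_rpow_le _ _ hz)
  have b₂ := norm_integral_clip_sub_le h₂ hp₁ hp₂ (h.integrable z.1) (h.integral_eq z.1)
    hz₂ (h.integrable_rpow z.1) (h.integral_rpow_le z.1)
  have e : meanDirection D G α lam₁ lam₂ z -
        ((1 - α) • (gradient F z.1 - gradient F z.2) + α • gradient F z.1) =
      (1 - α) • ((∫ s, clip (G z.1 s - G z.2 s) lam₁ ∂D) - (gradient F z.1 - gradient F z.2)) +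
        α • ((∫ s, clip (G z.1 s) lam₂ ∂D) - gradient F z.1) := by
    simp only [meanDirection, direction]
    have i₁ : Integrable (fun s => (1 - α) • clip (G z.1 s - G z.2 s) lam₁) D :=
      (integrable_clip hd h₁.le).smul (1 - α)
    have i₂ : Integrable (fun s => α • clip (G z.1 s) lam₂) D :=
      (integrable_clip (hGx z.1) h₂.le).smul α
    rw [integral_add i₁ i₂, integral_smul, integral_smul]
    simp only [smul_sub]
    abel
  rw [e]
  refine (norm_add_le _ _).trans ?_
  rw [norm_smul, norm_smul, Real.norm_of_nonneg (by linarith), Real.norm_of_nonneg hα₀]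
  calc _ ≤ 1 * (2 * α * lam₁) + α * (2 * α * lam₂) := by
        refine add_le_add (mul_le_mul (by linarith) b₁ (norm_nonneg _) zero_le_one) ?_
        gcongr
    _ = _ := by ring

end Direction

/-! ### The algorithm as an adapted process and its noise -/

section Run

variable {d : ℕ} {Ξ : Type*} (G : Pt d → Ξ → Pt d) (x₀ g₀ : Pt d) (γ α lam₁ lam₂ : ℝ) (s : ℕ → Ξ)

lemma run_next (t : ℕ) : (run G x₀ g₀ γ α lam₁ lam₂ s t).next =
    normStep γ (run G x₀ g₀ γ α lam₁ lam₂ s t).point (run G x₀ g₀ γ α lam₁ lam₂ s t).momentum := by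
  cases t <;> rfl

/-- The argument `(x_{t+1}, x_t)` of `direction` in step `t + 1`. -/
def pointPair (t : ℕ) : Pt d × Pt d :=
  ((run G x₀ g₀ γ α lam₁ lam₂ s t).next, (run G x₀ g₀ γ α lam₁ lam₂ s t).point)

lemma run_momentum_succ (t : ℕ) : (run G x₀ g₀ γ α lam₁ lam₂ s (t + 1)).momentum =
    (1 - α) • (run G x₀ g₀ γ α lam₁ lam₂ s t).momentum +
      direction G α lam₁ lam₂ (pointPair G x₀ g₀ γ α lam₁ lam₂ s t) (s (t + 1)) := by
  simp only [run, direction, pointPair, smul_add]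
  abel

/-- The exponentially weighted sum of the centered directions. -/
def noise [MeasurableSpace Ξ] (D : Measure Ξ) : ℕ → Pt d
  | 0 => 0
  | t + 1 => (1 - α) • noise D t +
      (direction G α lam₁ lam₂ (pointPair G x₀ g₀ γ α lam₁ lam₂ s t) (s (t + 1)) -
        meanDirection D G α lam₁ lam₂ (pointPair G x₀ g₀ γ α lam₁ lam₂ s t))

lemma norm_normStep_sub_le {γ : ℝ} (hγ : 0 ≤ γ) (x g : Pt d) : ‖normStep γ x g - x‖ ≤ γ := by
  rw [normStep, sub_sub_cancel_left, norm_neg, norm_smul, Real.norm_of_nonneg (by positivity),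
    mul_assoc]
  exact mul_le_of_le_one_right hγ (by
    rcases eq_or_ne ‖g‖ 0 with h | h
    · simp [h]
    · rw [inv_mul_cancel₀ h])

lemma norm_pointPair_sub_le {γ : ℝ} (hγ : 0 ≤ γ) (t : ℕ) :
    ‖(pointPair G x₀ g₀ γ α lam₁ lam₂ s t).1 - (pointPair G x₀ g₀ γ α lam₁ lam₂ s t).2‖ ≤ γ := by
  rw [pointPair, run_next]
  exact norm_normStep_sub_le hγ _ _

lemma measurable_normStep : Measurable fun z : Pt d × Pt d => normStep γ z.1 z.2 := by
  unfold normStep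
  fun_prop

variable {G} [MeasurableSpace Ξ] {Ω : Type*}

lemma measurable_run (hG : Measurable (Function.uncurry G)) (ξ : ℕ → Ω → Ξ) (t : ℕ) :
    Measurable[past ξ t] (fun ω => (run G x₀ g₀ γ α lam₁ lam₂ (fun t => ξ t ω) t).point) ∧
    Measurable[past ξ t] (fun ω => (run G x₀ g₀ γ α lam₁ lam₂ (fun t => ξ t ω) t).momentum) := by
  induction t with
  | zero => exact ⟨measurable_const, measurable_const⟩
  | succ t ih =>
    have h1 := ih.1.mono (past_mono ξ t.le_succ) le_rfl
    have h2 := ih.2.mono (past_mono ξ t.le_succ) le_rfl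
    have h3 : Measurable[past ξ (t + 1)]
        (fun ω => (run G x₀ g₀ γ α lam₁ lam₂ (fun t => ξ t ω) t).next) := by
      simp only [run_next]
      exact (measurable_normStep γ).comp (h1.prodMk h2)
    refine ⟨h3, ?_⟩
    simp only [run_momentum_succ]
    have h5 : Measurable[past ξ (t + 1)] (fun ω => direction G α lam₁ lam₂
        (pointPair G x₀ g₀ γ α lam₁ lam₂ (fun t => ξ t ω) t) (ξ (t + 1) ω)) :=
      @measurable_direction _ _ _ _ (past ξ (t + 1)) _ hG α lam₁ lam₂ _ _
        (h3.prodMk h1) (measurable_past ξ (t + 1))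
    exact (h2.const_smul (1 - α)).add h5

lemma measurable_pointPair (hG : Measurable (Function.uncurry G)) (ξ : ℕ → Ω → Ξ) (t : ℕ) :
    Measurable[past ξ t] (fun ω => pointPair G x₀ g₀ γ α lam₁ lam₂ (fun t => ξ t ω) t) := by
  have h := measurable_run x₀ g₀ γ α lam₁ lam₂ hG ξ t
  simp only [pointPair, run_next]
  exact ((measurable_normStep γ).comp (h.1.prodMk h.2)).prodMk h.1

/-- High-probability bound on the noise, uniformly over the time horizon. -/
lemma NoiseLevel.le_measureReal_forall_norm_noise_le [MeasurableSpace Ω] {μ : Measure Ω}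
    [IsProbabilityMeasure μ] {D : Measure Ξ} [IsProbabilityMeasure D] {ξ : ℕ → Ω → Ξ}
    (hξ : IIDSamples μ D ξ) {F : Pt d → ℝ} {p q α lam₁ lam₂ γ : ℝ}
    (h : NoiseLevel D F G p q α lam₁ lam₂ γ)
    (hG : Measurable (Function.uncurry G)) (hp₁ : 1 ≤ p) (hp₂ : p ≤ 2) (hq₁ : 1 ≤ q) (hq₂ : q ≤ 2)
    (hα₀ : 0 ≤ α) (hα₁ : α ≤ 1) (h₁ : 0 < lam₁) (h₂ : 0 < lam₂) (hγ : 0 ≤ γ) {T : ℕ} {β : ℝ}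
    (hT : 1 ≤ T) (hβ : 0 < β) :
    1 - β ≤ μ.real {ω | ∀ t < T, ‖noise G x₀ g₀ γ α lam₁ lam₂ (fun t => ξ t ω) D t‖ ≤
      4 * (lam₁ + α * lam₂) * Real.log (8 * T / β)} := by
  set B := lam₁ + α * lam₂
  have hB : 0 < B := by positivity
  -- Centred directions have norm at most 2B and second moment at most 4αB²; scaling by 1/(4B) gives
  -- 1/2 and α/4, within the limits 1 and α/2.
  set θ := (4 * B)⁻¹
  have hθ : 0 < θ := by positivity
  set U : ℕ → Ω → Pt d × Pt d := fun t ω => pointPair G x₀ g₀ γ α lam₁ lam₂ (fun t => ξ t ω) t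
  set k : Pt d × Pt d → Ξ → Pt d := fun z s =>
    θ • (direction G α lam₁ lam₂ z s - meanDirection D G α lam₁ lam₂ z)
  have hdir (z : Pt d × Pt d) : Integrable (direction G α lam₁ lam₂ z) D :=
    Integrable.of_bound
      (measurable_direction hG α lam₁ lam₂ measurable_const measurable_id).aestronglyMeasurable B
      (ae_of_all _ (norm_direction_le G hα₀ hα₁ h₁.le h₂.le z))
  have hmean (z : Pt d × Pt d) : ‖meanDirection D G α lam₁ lam₂ z‖ ≤ B := by
    simpa [meanDirection, B] using norm_integral_le_of_norm_le_const (μ := D)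
      (ae_of_all _ (norm_direction_le G hα₀ hα₁ h₁.le h₂.le z))
  have hk : Measurable (Function.uncurry k) :=
    ((measurable_direction hG α lam₁ lam₂ measurable_fst measurable_snd).sub
      ((measurable_meanDirection hG α lam₁ lam₂).comp measurable_fst)).const_smul θ
  have hexp := hξ.integral_cosh_le (U := U) (k := k)
    (S := fun t ω => θ • noise G x₀ g₀ γ α lam₁ lam₂ (fun t => ξ t ω) D t) hα₀ hα₁ hk
    (measurable_pointPair x₀ g₀ γ α lam₁ lam₂ hG ξ) (fun ω => smul_zero θ)
    (fun t ω => by simp only [noise, k, U, smul_add, smul_comm θ (1 - α)])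
    (fun t ω s => by
      simp only [k]
      rw [norm_smul, Real.norm_of_nonneg hθ.le]
      have h3 := norm_sub_le (direction G α lam₁ lam₂ (U t ω) s)
        (meanDirection D G α lam₁ lam₂ (U t ω))
      have h4 := norm_direction_le G hα₀ hα₁ h₁.le h₂.le (U t ω) s
      have h5 := hmean (U t ω)
      calc _ ≤ θ * (4 * B) := by gcongr; linarith
        _ = 1 := inv_mul_cancel₀ (by positivity))
    (fun t ω => by
      simp only [k]
      rw [integral_smul, integral_sub (hdir _) (integrable_const _)]
      simp [meanDirection])
    (fun t ω => by
      simp only [k, norm_smul, mul_pow, integral_const_mul]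
      have h3 := h.integral_sq_norm_le hG hp₁ hp₂ hq₁ hq₂ hα₀ hα₁ h₁ h₂ (z := U t ω)
        (norm_pointPair_sub_le G x₀ g₀ α lam₁ lam₂ _ hγ t)
      calc _ ≤ ‖θ‖ ^ 2 * (4 * α * B ^ 2) := by gcongr
        _ = α / 4 := by
          rw [Real.norm_of_nonneg hθ.le]
          simp only [θ]
          field_simp
        _ ≤ α / 2 := by linarith)
  refine (le_measureReal_forall_norm_le hT hβ (fun t => (hexp t).1) fun t => (hexp t).2).trans
    (measureReal_mono fun ω hω t ht => ?_)
  have h3 := hω t ht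
  rw [norm_smul, Real.norm_of_nonneg hθ.le, inv_mul_le_iff₀ (by positivity)] at h3
  exact h3

end Run

/-! ### Smooth descent with inexact normalized gradients -/

section Descent

variable {d : ℕ} {F : Pt d → ℝ} {L₁ : ℝ}

lemma LipschitzGradient.le_quadratic (h : LipschitzGradient F L₁) (x v : Pt d) :
    F (x + v) ≤ F x + inner ℝ (gradient F x) v + L₁ / 2 * ‖v‖ ^ 2 := by
  set φ : ℝ → ℝ := fun t =>
    F (x + t • v) - t * inner ℝ (gradient F x) v - L₁ / 2 * ‖v‖ ^ 2 * t ^ 2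
  have hφ (t : ℝ) : HasDerivAt φ (inner ℝ (gradient F (x + t • v)) v -
      inner ℝ (gradient F x) v - L₁ / 2 * ‖v‖ ^ 2 * (2 * t)) t := by
    have h1 : HasDerivAt (fun t : ℝ => x + t • v) v t := by
      simpa using ((hasDerivAt_id t).smul_const v).const_add x
    have h2 : HasDerivAt (fun t : ℝ => F (x + t • v)) (inner ℝ (gradient F (x + t • v)) v) t := by
      simpa [Function.comp_def] using (h.2.1 (x + t • v)).hasGradientAt.hasFDerivAt.comp_hasDerivAt t h1
    have h3 := (hasDerivAt_id t).mul_const (inner ℝ (gradient F x) v)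
    have h4 := (hasDerivAt_pow 2 t).const_mul (L₁ / 2 * ‖v‖ ^ 2)
    exact ((h2.sub h3).sub h4).congr_deriv (by simp)
  have hanti : AntitoneOn φ (Set.Icc 0 1) := by
    refine antitoneOn_of_deriv_nonpos (convex_Icc 0 1)
      (fun t _ => (hφ t).continuousAt.continuousWithinAt)
      (fun t _ => (hφ t).differentiableAt.differentiableWithinAt) fun t ht => ?_
    rw [interior_Icc] at ht
    rw [(hφ t).deriv, ← inner_sub_left]
    have h1 := real_inner_le_norm (gradient F (x + t • v) - gradient F x) v
    have h2 := h.2.2 (x + t • v) x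
    rw [add_sub_cancel_left, norm_smul, Real.norm_of_nonneg ht.1.le] at h2
    have h3 := mul_le_mul_of_nonneg_right h2 (norm_nonneg v)
    linarith
  have h01 := hanti (Set.left_mem_Icc.2 zero_le_one) (Set.right_mem_Icc.2 zero_le_one) zero_le_one
  simp only [φ, one_smul, zero_smul, add_zero] at h01
  linarith

/-- A gradient step of length parameter 1/L₁ cannot go below the infimum. -/
lemma LipschitzGradient.sq_norm_gradient_le (h : LipschitzGradient F L₁) (hL : 0 < L₁)
    (hF : BddBelow (Set.range F)) (x : Pt d) :
    ‖gradient F x‖ ^ 2 ≤ 2 * L₁ * initialGap F x := by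
  have h1 := h.le_quadratic x (-(L₁⁻¹ • gradient F x))
  have h2 := ciInf_le hF (x + -(L₁⁻¹ • gradient F x))
  rw [inner_neg_right, real_inner_smul_right, real_inner_self_eq_norm_sq, norm_neg, norm_smul,
    Real.norm_of_nonneg (by positivity), mul_pow] at h1
  have h3 : L₁⁻¹ * ‖gradient F x‖ ^ 2 - L₁ / 2 * (L₁⁻¹ ^ 2 * ‖gradient F x‖ ^ 2) ≤
      initialGap F x := by
    unfold initialGap
    linarith
  have h4 : 2 * L₁ * (L₁⁻¹ * ‖gradient F x‖ ^ 2 - L₁ / 2 * (L₁⁻¹ ^ 2 * ‖gradient F x‖ ^ 2)) =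
      ‖gradient F x‖ ^ 2 := by
    field_simp
    ring
  rw [← h4]
  gcongr

/-- Along g/‖g‖ the gradient has component at least ‖∇F‖ − 2‖g − ∇F‖. For `g = 0` the point does not
move, and the inequality survives because the error is then ‖∇F‖ itself. -/
lemma LipschitzGradient.normStep_le (h : LipschitzGradient F L₁) {γ : ℝ} (hγ : 0 ≤ γ)
    (x g : Pt d) :
    F (normStep γ x g) + γ * ‖gradient F x‖ ≤
      F x + 2 * γ * ‖g - gradient F x‖ + L₁ * γ ^ 2 / 2 := by
  have h1 := h.le_quadratic x (normStep γ x g - x)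
  rw [add_sub_cancel] at h1
  have h2 : L₁ / 2 * ‖normStep γ x g - x‖ ^ 2 ≤ L₁ / 2 * γ ^ 2 := by
    have := h.1
    have := norm_normStep_sub_le hγ x g
    gcongr
  have h3 : inner ℝ (gradient F x) (normStep γ x g - x) ≤
      γ * (2 * ‖g - gradient F x‖ - ‖gradient F x‖) := by
    rcases eq_or_ne g 0 with rfl | h0
    · simp only [normStep, smul_zero, sub_self, inner_zero_right, sub_zero, zero_sub, norm_neg]
      have := mul_nonneg hγ (norm_nonneg (gradient F x))
      linarith
    · have hg : 0 < ‖g‖ := norm_pos_iff.2 h0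
      rw [normStep, sub_sub_cancel_left, inner_neg_right, real_inner_smul_right]
      have h4 : inner ℝ (gradient F x) g = ‖g‖ ^ 2 - inner ℝ (g - gradient F x) g := by
        rw [inner_sub_left, real_inner_self_eq_norm_sq]; ring
      have h5 := real_inner_le_norm (g - gradient F x) g
      have h6 : ‖gradient F x‖ ≤ ‖g - gradient F x‖ + ‖g‖ := by
        have := norm_sub_le g (g - gradient F x)
        rw [sub_sub_cancel] at this
        linarith
      have h7 : ‖g‖⁻¹ * inner ℝ (g - gradient F x) g ≤ ‖g - gradient F x‖ := by
        rw [inv_mul_le_iff₀ hg]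
        linarith
      have h8 : ‖g‖⁻¹ * ‖g‖ ^ 2 = ‖g‖ := by field_simp
      rw [h4, mul_assoc, mul_sub, h8, ← mul_neg]
      gcongr
      linarith
  linarith

lemma mul_sum_add_le_of_contraction {R : ℕ → ℝ} {α b : ℝ} {n : ℕ}
    (h : ∀ t < n, R (t + 1) ≤ (1 - α) * R t + b) :
    α * ∑ t ∈ Finset.range n, R t + R n ≤ R 0 + n * b := by
  induction n with
  | zero => simp
  | succ n ih =>
    have h1 := ih fun t ht => h t (ht.trans n.lt_succ_self)
    have h2 := h n n.lt_succ_self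
    rw [Finset.sum_range_succ]
    push_cast
    linarith

/-- Deterministic analysis of normalized descent along approximate gradients `g t`, whose error is
`S t` up to a drift that contracts with rate `α`. -/
lemma LipschitzGradient.sum_norm_gradient_le (h : LipschitzGradient F L₁)
    (hF : BddBelow (Set.range F)) {γ α B r Δ : ℝ} {T : ℕ} {x g S : ℕ → Pt d}
    (hγ : 0 ≤ γ) (hα₀ : 0 < α) (hα₁ : α ≤ 1) (hB : 0 ≤ B)
    (hr : 0 ≤ r) (hx : ∀ t, x (t + 1) = normStep γ (x t) (g t)) (hg₀ : g 0 = 0) (hS₀ : S 0 = 0)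
    (hΔ : initialGap F (x 0) = Δ)
    (hbias : ∀ t, initialGap F (x (t + 1)) ≤ 2 * Δ →
      ‖(g (t + 1) - gradient F (x (t + 1)) - S (t + 1)) -
        (1 - α) • (g t - gradient F (x t) - S t)‖ ≤ 2 * α * B)
    (hS : ∀ t < T, ‖S t‖ ≤ r)
    (hbudget : 2 * γ * (‖gradient F (x 0)‖ / α + T * (2 * B + r)) + T * (L₁ * γ ^ 2 / 2) ≤ Δ) :
    γ * ∑ t ∈ Finset.range T, ‖gradient F (x t)‖ ≤ 2 * Δ := by
  have hL := h.1
  have htel (n : ℕ) : F (x n) + γ * ∑ t ∈ Finset.range n, ‖gradient F (x t)‖ ≤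
      F (x 0) + 2 * γ * ∑ t ∈ Finset.range n, ‖g t - gradient F (x t)‖ + n * (L₁ * γ ^ 2 / 2) := by
    induction n with
    | zero => simp
    | succ n ih =>
      have := h.normStep_le hγ (x n) (g n)
      rw [Finset.sum_range_succ, Finset.sum_range_succ, hx]
      push_cast
      linarith
  have hmain (n : ℕ) (hn : n ≤ T) :
      F (x n) + γ * ∑ t ∈ Finset.range n, ‖gradient F (x t)‖ ≤ F (x 0) + Δ := by
    induction n using Nat.strong_induction_on with
    | _ n ih =>
      -- The drift starts at ‖∇F(x₀)‖ because the momentum starts at 0; summing the contraction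
      -- turns this into ‖∇F(x₀)‖/α.
      set R : ℕ → ℝ := fun t => ‖g t - gradient F (x t) - S t‖
      have hR₀ : R 0 = ‖gradient F (x 0)‖ := by simp [R, hg₀, hS₀]
      have hR : ∑ t ∈ Finset.range n, R t ≤ ‖gradient F (x 0)‖ / α + n * (2 * B) := by
        rcases n with _ | n
        · simp; positivity
        have hstep : ∀ t < n, R (t + 1) ≤ (1 - α) * R t + 2 * α * B := fun t ht => by
          -- The errors before time n involve only x_1, …, x_{n−1}, whose gaps are bounded by the
          -- induction hypothesis.
          have h1 : initialGap F (x (t + 1)) ≤ 2 * Δ := by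
            have h2 := ih (t + 1) (by omega) (by omega)
            have h3 : 0 ≤ γ * ∑ t ∈ Finset.range (t + 1), ‖gradient F (x t)‖ :=
              mul_nonneg hγ (Finset.sum_nonneg fun _ _ => norm_nonneg _)
            unfold initialGap at hΔ ⊢
            linarith
          have h2 := norm_le_norm_add_norm_sub' (g (t + 1) - gradient F (x (t + 1)) - S (t + 1))
            ((1 - α) • (g t - gradient F (x t) - S t))
          rw [norm_smul, Real.norm_of_nonneg (by linarith)] at h2
          have := hbias t h1
          simp only [R]
          linarith
        have h1 := mul_sum_add_le_of_contraction hstep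
        have h2 : α * ∑ t ∈ Finset.range (n + 1), R t ≤ ‖gradient F (x 0)‖ + n * (2 * α * B) := by
          rw [Finset.sum_range_succ, mul_add, ← hR₀]
          have := mul_le_of_le_one_left (norm_nonneg (g n - gradient F (x n) - S n)) hα₁
          linarith
        have h3 : ∑ t ∈ Finset.range (n + 1), R t ≤
            (‖gradient F (x 0)‖ + n * (2 * α * B)) / α := by
          rw [le_div_iff₀ hα₀]
          linarith
        calc _ ≤ _ := h3
          _ = ‖gradient F (x 0)‖ / α + n * (2 * B) := by field_simp
          _ ≤ _ := by push_cast; linarith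
      have hε : ∑ t ∈ Finset.range n, ‖g t - gradient F (x t)‖ ≤
          ‖gradient F (x 0)‖ / α + T * (2 * B + r) := by
        calc _ ≤ ∑ t ∈ Finset.range n, (R t + r) := by
              refine Finset.sum_le_sum fun t ht => ?_
              have h1 := norm_le_norm_add_norm_sub' (g t - gradient F (x t)) (S t)
              have h2 := hS t ((Finset.mem_range.1 ht).trans_le hn)
              simp only [R]
              linarith
          _ = ∑ t ∈ Finset.range n, R t + n * r := by
              rw [Finset.sum_add_distrib]; simp
          _ ≤ ‖gradient F (x 0)‖ / α + n * (2 * B + r) := by linarith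
          _ ≤ _ := by gcongr
      have h1 := htel n
      have h2 := mul_le_mul_of_nonneg_left hε (by positivity : 0 ≤ 2 * γ)
      have h3 : (n : ℝ) * (L₁ * γ ^ 2 / 2) ≤ T * (L₁ * γ ^ 2 / 2) := by gcongr
      linarith
  have h1 := hmain T le_rfl
  have h2 := ciInf_le hF (x T)
  unfold initialGap at hΔ
  linarith

end Descent

/-! ### Stepsize, thresholds and the resulting rate -/

section Parameters

variable {L₁ σ₁ δ Δ p q α ℓ γ : ℝ} {T : ℕ}

lemma stepScale_le (L₁ σ₁ δ Δ p q α : ℝ) (T : ℕ) (ℓ : ℝ) :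
    stepScale L₁ σ₁ δ Δ p q α T ℓ ≤ α * √(Δ / L₁) ∧
    stepScale L₁ σ₁ δ Δ p q α T ℓ ≤ 1 / (α * T * ℓ) * √(Δ / L₁) ∧
    stepScale L₁ σ₁ δ Δ p q α T ℓ ≤ Δ / (σ₁ * α ^ ((p - 1) / p) * T * ℓ) ∧
    stepScale L₁ σ₁ δ Δ p q α T ℓ ≤ √(Δ / (L₁ * T * ℓ)) ∧
    (δ ≠ 0 → stepScale L₁ σ₁ δ Δ p q α T ℓ ≤ √(Δ * α ^ (1 / q) / (δ * T * ℓ))) := by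
  have h : stepScale L₁ σ₁ δ Δ p q α T ℓ ≤
      min (min (α * √(Δ / L₁)) (1 / (α * T * ℓ) * √(Δ / L₁)))
        (min (Δ / (σ₁ * α ^ ((p - 1) / p) * T * ℓ)) (√(Δ / (L₁ * T * ℓ)))) := by
    unfold stepScale
    dsimp only
    split_ifs
    · exact le_rfl
    · exact min_le_left _ _
  simp only [le_min_iff] at h
  refine ⟨h.1.1, h.1.2, h.2.1, h.2.2, fun hδ => ?_⟩
  unfold stepScale
  dsimp only
  rw [if_neg hδ]
  exact min_le_right _ _

/-- With division by zero equal to zero, √(Δ/L₁) vanishes if `L₁ = 0` or `Δ = 0`, and then the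
minimum is not positive. -/
lemma pos_of_stepScale_pos (hL : 0 ≤ L₁) (hΔ : 0 ≤ Δ)
    (h : 0 < stepScale L₁ σ₁ δ Δ p q α T ℓ) : 0 < L₁ ∧ 0 < Δ := by
  have h1 := h.trans_le (stepScale_le L₁ σ₁ δ Δ p q α T ℓ).1
  constructor
  · refine hL.lt_of_ne fun h0 => ?_
    simp [← h0] at h1
  · refine hΔ.lt_of_ne fun h0 => ?_
    simp [← h0] at h1

lemma sqrt_mul_sqrt_div (hL : 0 < L₁) (hΔ : 0 ≤ Δ) : √(L₁ * Δ) * √(Δ / L₁) = Δ := by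
  rw [← Real.sqrt_mul (by positivity), show L₁ * Δ * (Δ / L₁) = Δ ^ 2 by field_simp,
    Real.sqrt_sq hΔ]

/-- The stepsize restriction keeps the accumulated error below the initial gap. -/
lemma stepsize_budget (hL : 0 < L₁) (hΔ : 0 < Δ) (hσ : 0 < σ₁) (hδ : 0 ≤ δ) (hp : 1 < p)
    (hα₀ : 0 < α) (hT : 1 ≤ T) (hℓ : 1 ≤ ℓ) (hγ : 0 < γ)
    (hM : γ ≤ 1 / 100 * stepScale L₁ σ₁ δ Δ p q α T ℓ) {n : ℝ} (hn : n ≤ 2 * √(L₁ * Δ)) :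
    2 * γ * (n / α + T * (2 * (threshold₁ L₁ δ q α γ + α * threshold₂ L₁ σ₁ Δ p α) +
      4 * (threshold₁ L₁ δ q α γ + α * threshold₂ L₁ σ₁ Δ p α) * ℓ)) +
      T * (L₁ * γ ^ 2 / 2) ≤ Δ := by
  have hT' : (0 : ℝ) < T := by positivity
  have hℓ' : 0 < ℓ := by linarith
  obtain ⟨m₁, m₂, m₃, m₄, m₅⟩ := stepScale_le L₁ σ₁ δ Δ p q α T ℓ
  set M := stepScale L₁ σ₁ δ Δ p q α T ℓ
  set s := √(L₁ * Δ)
  have hs : 0 ≤ s := Real.sqrt_nonneg _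
  have hss : s * √(Δ / L₁) = Δ := sqrt_mul_sqrt_div hL hΔ.le
  have hM0 : 0 < M := by linarith
  have hγ2 : γ ^ 2 ≤ 1 / 10000 * M ^ 2 := by
    calc γ ^ 2 ≤ (1 / 100 * M) ^ 2 := by gcongr
      _ = _ := by ring
  -- Each of the five estimates `a`, `b`, `c`, `e`, `f` uses one term of the minimum; the terms
  -- under a root enter through γ².
  have a : γ * s / α ≤ 1 / 100 * Δ := by
    rw [div_le_iff₀ hα₀]
    calc γ * s ≤ 1 / 100 * (α * √(Δ / L₁)) * s := by gcongr; linarith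
      _ = 1 / 100 * (s * √(Δ / L₁)) * α := by ring
      _ = _ := by rw [hss]
  have b : γ * T * ℓ * (α * s) ≤ 1 / 100 * Δ := by
    calc γ * T * ℓ * (α * s) ≤ 1 / 100 * (1 / (α * T * ℓ) * √(Δ / L₁)) * T * ℓ * (α * s) := by
          gcongr; linarith
      _ = 1 / 100 * (s * √(Δ / L₁)) := by field_simp
      _ = _ := by rw [hss]
  have c : γ * T * ℓ * (σ₁ * α ^ ((p - 1) / p)) ≤ 1 / 100 * Δ := by
    have hpos : 0 < α ^ ((p - 1) / p) := by positivity
    calc γ * T * ℓ * (σ₁ * α ^ ((p - 1) / p))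
        ≤ 1 / 100 * (Δ / (σ₁ * α ^ ((p - 1) / p) * T * ℓ)) * T * ℓ * (σ₁ * α ^ ((p - 1) / p)) := by
          gcongr; linarith
      _ = _ := by field_simp
  have e : γ ^ 2 * (L₁ * T * ℓ) ≤ 1 / 10000 * Δ := by
    have h1 : M ^ 2 ≤ Δ / (L₁ * T * ℓ) := by
      calc M ^ 2 ≤ √(Δ / (L₁ * T * ℓ)) ^ 2 := by gcongr
        _ = _ := Real.sq_sqrt (by positivity)
    rw [le_div_iff₀ (by positivity)] at h1
    have h2 := mul_le_mul_of_nonneg_right hγ2 (by positivity : 0 ≤ L₁ * T * ℓ)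
    linarith
  have f : γ ^ 2 * (δ * α ^ (-(1 / q)) * T * ℓ) ≤ 1 / 10000 * Δ := by
    rcases hδ.eq_or_lt with h0 | h0
    · rw [← h0]
      simpa using hΔ.le
    have hpos : 0 < α ^ (1 / q) := by positivity
    have h1 : M ^ 2 ≤ Δ * α ^ (1 / q) / (δ * T * ℓ) := by
      calc M ^ 2 ≤ √(Δ * α ^ (1 / q) / (δ * T * ℓ)) ^ 2 := by gcongr; exact m₅ h0.ne'
        _ = _ := Real.sq_sqrt (by positivity)
    rw [le_div_iff₀ (by positivity)] at h1
    rw [Real.rpow_neg hα₀.le]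
    have h2 : M ^ 2 * (δ * (α ^ (1 / q))⁻¹ * T * ℓ) ≤ Δ := by
      rw [show M ^ 2 * (δ * (α ^ (1 / q))⁻¹ * T * ℓ) = M ^ 2 * (δ * T * ℓ) / α ^ (1 / q) by
        field_simp, div_le_iff₀ hpos]
      exact h1
    have h3 := mul_le_mul_of_nonneg_right hγ2
      (by positivity : 0 ≤ δ * (α ^ (1 / q))⁻¹ * T * ℓ)
    linarith
  have t₁ : threshold₁ L₁ δ q α γ ≤ 2 * γ * L₁ + γ * δ * α ^ (-(1 / q)) :=
    max_le_add_of_nonneg (by positivity) (by positivity)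
  have t₂ : α * threshold₂ L₁ σ₁ Δ p α ≤ 4 * (α * s) + σ₁ * α ^ ((p - 1) / p) := by
    have h1 : threshold₂ L₁ σ₁ Δ p α ≤ 4 * s + σ₁ * α ^ (-(1 / p)) :=
      max_le_add_of_nonneg (by positivity) (by positivity)
    have h2 : α ^ ((p - 1) / p) = α * α ^ (-(1 / p)) := by
      rw [show (p - 1) / p = 1 + -(1 / p) by field_simp; ring, Real.rpow_add hα₀, Real.rpow_one]
    rw [h2]
    calc _ ≤ α * (4 * s + σ₁ * α ^ (-(1 / p))) := by gcongr
      _ = _ := by ring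
  set B := threshold₁ L₁ δ q α γ + α * threshold₂ L₁ σ₁ Δ p α
  have hB₀ : 0 ≤ B := by
    have h1 : 0 ≤ threshold₁ L₁ δ q α γ := le_max_of_le_left (by positivity)
    have h2 : 0 ≤ threshold₂ L₁ σ₁ Δ p α := le_max_of_le_left (by positivity)
    positivity
  have hB : γ * T * ℓ * B ≤ 6 / 100 * Δ := by
    calc γ * T * ℓ * B ≤ γ * T * ℓ * ((2 * γ * L₁ + γ * δ * α ^ (-(1 / q))) +
          (4 * (α * s) + σ₁ * α ^ ((p - 1) / p))) := by
          gcongr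
          exact add_le_add t₁ t₂
      _ = 2 * (γ ^ 2 * (L₁ * T * ℓ)) + γ ^ 2 * (δ * α ^ (-(1 / q)) * T * ℓ) +
          4 * (γ * T * ℓ * (α * s)) + γ * T * ℓ * (σ₁ * α ^ ((p - 1) / p)) := by ring
      _ ≤ _ := by linarith
  have h1 : γ * (n / α) ≤ 2 / 100 * Δ := by
    calc γ * (n / α) ≤ γ * (2 * s / α) := by gcongr
      _ = 2 * (γ * s / α) := by ring
      _ ≤ _ := by linarith
  have h2 : γ * (T * (2 * B + 4 * B * ℓ)) ≤ 6 * (γ * T * ℓ * B) := by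
    have : γ * T * B * 1 ≤ γ * T * B * ℓ := by gcongr
    linarith
  have h3 : T * (L₁ * γ ^ 2 / 2) ≤ γ ^ 2 * (L₁ * T * ℓ) := by
    have h4 : γ ^ 2 * (L₁ * T) * 1 ≤ γ ^ 2 * (L₁ * T) * ℓ := by gcongr
    have h5 : 0 ≤ γ ^ 2 * (L₁ * T) := by positivity
    linarith
  linarith

/-- The second entry of each threshold solves αλ^r = (moment bound): λ = σ₁α^(−1/p), and λ =
γδα^(−1/q) for points at distance at most γ. -/
lemma noiseLevel {d : ℕ} {Ξ : Type*} [MeasurableSpace Ξ] {D : Measure Ξ} {F : Pt d → ℝ}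
    {G : Pt d → Ξ → Pt d} (hc : BoundedCentralMoment D F G p σ₁) (hs : Similarity D F G q δ)
    (hp : 1 < p) (hq : 1 ≤ q) (hα : 0 < α) (hγ : 0 ≤ γ) :
    NoiseLevel D F G p q α (threshold₁ L₁ δ q α γ) (threshold₂ L₁ σ₁ Δ p α) γ := by
  have hpow {a r : ℝ} (ha : 0 ≤ a) (hr : 0 < r) : α * (a * α ^ (-(1 / r))) ^ r = a ^ r := by
    rw [Real.mul_rpow ha (by positivity), ← Real.rpow_mul hα.le,
      show -(1 / r) * r = -1 by field_simp, Real.rpow_neg_one]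
    field_simp
  have hσ := hc.1
  have hδ := hs.1
  refine ⟨fun x => (hc.2 x).1, fun x => (hc.2 x).2.1, fun x => (hc.2 x).2.2.1,
    fun x => (hc.2 x).2.2.2.trans ?_, fun x y => (hs.2 x y).1,
    fun x y hxy => (hs.2 x y).2.trans ?_⟩
  · rw [← hpow hσ.le (by linarith : 0 < p)]
    gcongr
    exact le_max_right _ _
  · rw [← Real.mul_rpow hδ (norm_nonneg _)]
    calc (δ * ‖x - y‖) ^ q ≤ (γ * δ) ^ q := by
          rw [mul_comm γ]
          gcongr
      _ = α * (γ * δ * α ^ (-(1 / q))) ^ q := (hpow (by positivity) (by linarith)).symm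
      _ ≤ _ := by
          gcongr
          exact le_max_right _ _

lemma momentumParam_pos (hT : 1 ≤ T) : 0 < momentumParam p q T :=
  lt_max_of_lt_left (by positivity)

lemma expo₂_denominator_pos (hp : 1 < p) (hq : 1 ≤ q) : 0 < p * (2 * q + 1) - 2 * q := by
  have : 0 < (p - 1) * q := mul_pos (by linarith) (by linarith)
  linarith

lemma momentumParam_le_one (hp : 1 < p) (hq : 1 ≤ q) (hT : 1 ≤ T) : momentumParam p q T ≤ 1 := by
  have hT' : (1 : ℝ) ≤ T := by exact_mod_cast hT
  have := expo₂_denominator_pos hp hq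
  refine max_le (Real.rpow_le_one_of_one_le_of_nonpos hT' (neg_nonpos.2 ?_))
    (Real.rpow_le_one_of_one_le_of_nonpos hT' (neg_nonpos.2 ?_))
  · exact div_nonneg (by linarith) (by linarith)
  · have : 0 < p * q := mul_pos (by linarith) (by linarith)
    positivity

/-- Raised to (p − 1)/p, the two candidates for α become T^(−`expo₁`) and T^(−`expo₂`); whichever is
the maximum, the smaller exponent bounds it. -/
lemma momentumParam_rpow_le (hp : 1 < p) (hq : 1 ≤ q) (hT : 1 ≤ T) :
    momentumParam p q T ^ ((p - 1) / p) ≤ (T : ℝ) ^ (-min (expo₁ p) (expo₂ p q)) := by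
  have hT' : (1 : ℝ) ≤ T := by exact_mod_cast hT
  have hD := expo₂_denominator_pos hp hq
  have hD₁ : 0 < 2 * p - 1 := by linarith
  have hp₀ : 0 < p := by linarith
  rcases max_choice ((T : ℝ) ^ (-(p / (2 * p - 1))))
    ((T : ℝ) ^ (-(p * q / (p * (2 * q + 1) - 2 * q)))) with h | h <;>
  · rw [momentumParam, h, ← Real.rpow_mul (by positivity)]
    refine Real.rpow_le_rpow_of_exponent_le hT' ?_
    rw [neg_mul, neg_le_neg_iff]
    first
    | refine (min_le_left _ _).trans_eq ?_
      unfold expo₁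
      field_simp
      done
    | refine (min_le_right _ _).trans_eq ?_
      unfold expo₂
      field_simp

lemma momentumParam_le (hp : 1 < p) (hq : 1 ≤ q) (hT : 1 ≤ T) :
    momentumParam p q T ≤ (T : ℝ) ^ (-min (expo₁ p) (expo₂ p q)) := by
  refine le_trans ?_ (momentumParam_rpow_le hp hq hT)
  exact Real.self_le_rpow_of_le_one (momentumParam_pos hT).le (momentumParam_le_one hp hq hT)
    ((div_le_one (by linarith)).2 (by linarith))

/-- The rate dominates `Δ / (M T)` for the scale `M` of the stepsize. -/
lemma gap_le_stepScale_mul_rate (hL : 0 < L₁) (hΔ : 0 < Δ) (hσ : 0 < σ₁) (hδ : 0 ≤ δ)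
    (hp : 1 < p) (hq : 1 ≤ q) (hT : 1 ≤ T) (hℓ : 1 ≤ ℓ) :
    Δ ≤ stepScale L₁ σ₁ δ Δ p q (momentumParam p q T) T ℓ * (T * rate L₁ σ₁ δ Δ p q T ℓ) := by
  have hT1 : (1 : ℝ) ≤ T := by exact_mod_cast hT
  have hT' : (0 : ℝ) < T := by positivity
  have hℓ' : 0 < ℓ := by linarith
  have hD := expo₂_denominator_pos hp hq
  have hD₁ : 0 < 2 * p - 1 := by linarith
  have hp₀ : 0 < p := by linarith
  have hq₀ : 0 < q := by linarith
  have hαle := momentumParam_le hp hq hT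
  have hαp := momentumParam_rpow_le hp hq hT
  have hα₀ : 0 < momentumParam p q T := momentumParam_pos hT
  have hα₁ : (T : ℝ) ^ (-(p / (2 * p - 1))) ≤ momentumParam p q T := le_max_left _ _
  have hα₂ : (T : ℝ) ^ (-(p * q / (p * (2 * q + 1) - 2 * q))) ≤ momentumParam p q T :=
    le_max_right _ _
  set α := momentumParam p q T
  set r := min (expo₁ p) (expo₂ p q)
  set s := √(L₁ * Δ)
  have hs₀ : 0 ≤ s := Real.sqrt_nonneg _
  have hs : s * √(Δ / L₁) = Δ := sqrt_mul_sqrt_div hL hΔ.le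
  have hTr : 0 < (T : ℝ) ^ (-r) := by positivity
  have hrate : rate L₁ σ₁ δ Δ p q T ℓ =
      (s + σ₁) * (T : ℝ) ^ (-r) * ℓ + √(δ * Δ) * (T : ℝ) ^ (-expo₂ p q) * √ℓ := by
    rw [rate, Real.rpow_neg hT'.le, Real.rpow_neg hT'.le, div_eq_mul_inv, div_eq_mul_inv]
  have hr₁ : s * (T : ℝ) ^ (-r) * ℓ ≤ rate L₁ σ₁ δ Δ p q T ℓ := by
    rw [hrate]
    have h1 : 0 ≤ σ₁ * (T : ℝ) ^ (-r) * ℓ := by positivity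
    have h2 : 0 ≤ √(δ * Δ) * (T : ℝ) ^ (-expo₂ p q) * √ℓ := by positivity
    linarith
  have hr₂ : σ₁ * (T : ℝ) ^ (-r) * ℓ ≤ rate L₁ σ₁ δ Δ p q T ℓ := by
    rw [hrate]
    have h1 : 0 ≤ s * (T : ℝ) ^ (-r) * ℓ := by positivity
    have h2 : 0 ≤ √(δ * Δ) * (T : ℝ) ^ (-expo₂ p q) * √ℓ := by positivity
    linarith
  have hr₃ : √(δ * Δ) * (T : ℝ) ^ (-expo₂ p q) * √ℓ ≤ rate L₁ σ₁ δ Δ p q T ℓ := by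
    rw [hrate]
    have h1 : 0 ≤ (s + σ₁) * (T : ℝ) ^ (-r) * ℓ := by positivity
    linarith
  have hR : 0 < rate L₁ σ₁ δ Δ p q T ℓ := lt_of_lt_of_le (by positivity) hr₂
  set R := rate L₁ σ₁ δ Δ p q T ℓ
  -- Here a lower bound on α is needed; the first candidate satisfies T^(−p/(2p−1)) · T ·
  -- T^(−`expo₁`) = 1.
  have x₁ : Δ ≤ α * √(Δ / L₁) * (T * R) := by
    have h1 : (T : ℝ) ^ (-(p / (2 * p - 1))) * (T * (T : ℝ) ^ (-expo₁ p)) = 1 := by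
      have he : 1 + -expo₁ p = p / (2 * p - 1) := by
        rw [expo₁, eq_div_iff hD₁.ne', add_mul, neg_mul, div_mul_cancel₀ _ hD₁.ne']
        ring
      rw [← Real.rpow_one_add' hT'.le (he ▸ (div_pos hp₀ hD₁).ne'), ← Real.rpow_add hT', he,
        neg_add_cancel, Real.rpow_zero]
    have h2 : (T : ℝ) ^ (-expo₁ p) ≤ (T : ℝ) ^ (-r) :=
      Real.rpow_le_rpow_of_exponent_le hT1 (neg_le_neg (min_le_left _ _))
    calc Δ = 1 * (s * √(Δ / L₁)) := by rw [hs, one_mul]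
      _ ≤ α * (T * (T : ℝ) ^ (-r)) * (s * √(Δ / L₁)) := by
          gcongr
          rw [← h1]
          gcongr
      _ = α * √(Δ / L₁) * (T * (s * (T : ℝ) ^ (-r) * 1)) := by ring
      _ ≤ α * √(Δ / L₁) * (T * (s * (T : ℝ) ^ (-r) * ℓ)) := by gcongr
      _ ≤ _ := by gcongr
  have x₂ : Δ ≤ 1 / (α * T * ℓ) * √(Δ / L₁) * (T * R) := by
    calc Δ = α * (1 / α) * (s * √(Δ / L₁)) := by rw [hs]; field_simp
      _ ≤ (T : ℝ) ^ (-r) * (1 / α) * (s * √(Δ / L₁)) := by gcongr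
      _ = 1 / (α * T * ℓ) * √(Δ / L₁) * (T * (s * (T : ℝ) ^ (-r) * ℓ)) := by field_simp
      _ ≤ _ := by gcongr
  have x₃ : Δ ≤ Δ / (σ₁ * α ^ ((p - 1) / p) * T * ℓ) * (T * R) := by
    have hpos : 0 < α ^ ((p - 1) / p) := by positivity
    calc Δ = Δ / α ^ ((p - 1) / p) * α ^ ((p - 1) / p) := by field_simp
      _ ≤ Δ / α ^ ((p - 1) / p) * (T : ℝ) ^ (-r) := by gcongr
      _ = Δ / (σ₁ * α ^ ((p - 1) / p) * T * ℓ) * (T * (σ₁ * (T : ℝ) ^ (-r) * ℓ)) := by field_simp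
      _ ≤ _ := by gcongr
  have x₄ : Δ ≤ √(Δ / (L₁ * T * ℓ)) * (T * R) := by
    have h1 : √(Δ / (L₁ * T * ℓ)) = √(Δ / L₁) / (√T * √ℓ) := by
      rw [← Real.sqrt_mul hT'.le, ← Real.sqrt_div' _ (by positivity)]
      congr 1
      field_simp
    -- `expo₁` is below 1/2, so this term never determines the rate.
    have h2 : (T : ℝ) ^ (-(1 / 2) : ℝ) ≤ (T : ℝ) ^ (-r) := by
      refine Real.rpow_le_rpow_of_exponent_le hT1 (neg_le_neg ((min_le_left _ _).trans ?_))
      rw [expo₁, div_le_div_iff₀ hD₁ (by norm_num)]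
      linarith
    have h3 : √(T : ℝ) ≤ T * (T : ℝ) ^ (-r) := by
      calc √(T : ℝ) = T * (T : ℝ) ^ (-(1 / 2) : ℝ) := by
            rw [Real.rpow_neg hT'.le, ← Real.sqrt_eq_rpow, ← div_eq_mul_inv, Real.div_sqrt]
        _ ≤ _ := by gcongr
    have h4 : √ℓ ≤ ℓ := by
      rw [Real.sqrt_le_left (by positivity)]
      nlinarith
    have hsT : 0 < √(T : ℝ) := Real.sqrt_pos.2 hT'
    have hsℓ : 0 < √ℓ := Real.sqrt_pos.2 hℓ'
    calc Δ = (s * √(Δ / L₁)) / (√T * √ℓ) * (√T * √ℓ) := by rw [hs]; field_simp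
      _ ≤ (s * √(Δ / L₁)) / (√T * √ℓ) * (T * (T : ℝ) ^ (-r) * ℓ) := by gcongr
      _ = √(Δ / L₁) / (√T * √ℓ) * (T * (s * (T : ℝ) ^ (-r) * ℓ)) := by ring
      _ ≤ _ := by rw [h1]; gcongr
  have hX {u : ℝ} (h : Δ ≤ u * (T * R)) : Δ / (T * R) ≤ u := (div_le_iff₀ (by positivity)).2 h
  refine (div_le_iff₀ (by positivity)).1 ?_
  have hmin : Δ / (T * R) ≤ min (min (α * √(Δ / L₁)) (1 / (α * T * ℓ) * √(Δ / L₁)))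
      (min (Δ / (σ₁ * α ^ ((p - 1) / p) * T * ℓ)) (√(Δ / (L₁ * T * ℓ)))) :=
    le_min (le_min (hX x₁) (hX x₂)) (le_min (hX x₃) (hX x₄))
  unfold stepScale
  dsimp only
  split_ifs with h0
  · exact hmin
  refine le_min hmin (hX ?_)
  have hδ' : 0 < δ := hδ.lt_of_ne (Ne.symm h0)
  -- The second candidate for α is made for the δ term: 2 `expo₂` − 1 = −p/(p(2q+1) − 2q).
  have h1 : (T : ℝ) ^ (2 * expo₂ p q - 1) ≤ α ^ (1 / q) := by
    calc (T : ℝ) ^ (2 * expo₂ p q - 1)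
        = ((T : ℝ) ^ (-(p * q / (p * (2 * q + 1) - 2 * q)))) ^ (1 / q) := by
          rw [← Real.rpow_mul hT'.le]
          congr 1
          unfold expo₂
          field_simp
          ring
      _ ≤ _ := by gcongr
  have h2 : (T : ℝ) ^ (2 * expo₂ p q - 1) = ((T : ℝ) ^ (expo₂ p q)) ^ 2 / T := by
    rw [Real.rpow_sub_one hT'.ne', mul_comm, Real.rpow_mul hT'.le, Real.rpow_two]
  have h3 : Δ * (T : ℝ) ^ (expo₂ p q) / T ≤ √(Δ * α ^ (1 / q) / (δ * T * ℓ)) * (√(δ * Δ) * √ℓ) := by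
    rw [← Real.sqrt_mul (by positivity), ← Real.sqrt_mul (by positivity)]
    refine Real.le_sqrt_of_sq_le ?_
    rw [h2] at h1
    calc (Δ * (T : ℝ) ^ (expo₂ p q) / T) ^ 2
        = Δ ^ 2 / T * (((T : ℝ) ^ (expo₂ p q)) ^ 2 / T) := by field_simp
      _ ≤ Δ ^ 2 / T * α ^ (1 / q) := by gcongr
      _ = _ := by field_simp
  have hTe : 0 < (T : ℝ) ^ (expo₂ p q) := by positivity
  calc Δ = Δ * (T : ℝ) ^ (expo₂ p q) / T * (T * (T : ℝ) ^ (-expo₂ p q)) := by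
        rw [Real.rpow_neg hT'.le]; field_simp
    _ ≤ √(Δ * α ^ (1 / q) / (δ * T * ℓ)) * (√(δ * Δ) * √ℓ) * (T * (T : ℝ) ^ (-expo₂ p q)) := by
        gcongr
    _ = √(Δ * α ^ (1 / q) / (δ * T * ℓ)) * (T * (√(δ * Δ) * (T : ℝ) ^ (-expo₂ p q) * √ℓ)) := by
        ring
    _ ≤ _ := by gcongr

lemma one_le_log {β : ℝ} (hT : 1 ≤ T) (hβ₀ : 0 < β) (hβ₁ : β ≤ 1) :
    1 ≤ Real.log (8 * T / β) := by
  have hT1 : (1 : ℝ) ≤ T := by exact_mod_cast hT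
  have h8 : (8 : ℝ) ≤ 8 * T / β := by
    rw [le_div_iff₀ hβ₀]
    linarith
  rw [Real.le_log_iff_exp_le (by linarith)]
  have := Real.exp_one_lt_d9
  linarith

lemma log_le_four_mul_log {β : ℝ} (hT : 1 ≤ T) (hβ₀ : 0 < β) (h : 2 * β ≤ T) :
    Real.log (8 * T / β) ≤ 4 * Real.log (T / β) := by
  have hT' : (0 : ℝ) < T := by positivity
  -- As 8 = 2³ ≤ (T/β)³, the factor 8 costs three further logarithms.
  have h2 : (2 : ℝ) ≤ T / β := (le_div_iff₀ hβ₀).2 h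
  calc Real.log (8 * T / β) ≤ Real.log ((T / β) ^ 4) := by
        refine Real.log_le_log (by positivity) ?_
        calc 8 * T / β = 2 ^ 3 * (T / β) := by ring
          _ ≤ (T / β) ^ 3 * (T / β) := by gcongr
          _ = _ := by ring
    _ = _ := by rw [Real.log_pow]; norm_num

lemma rate_le_four_mul_rate {ℓ' : ℝ} (hσ : 0 ≤ σ₁) (hℓ' : 0 ≤ ℓ') (h : ℓ ≤ 4 * ℓ') :
    rate L₁ σ₁ δ Δ p q T ℓ ≤ 4 * rate L₁ σ₁ δ Δ p q T ℓ' := by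
  have h1 : √ℓ ≤ 4 * √ℓ' := by
    calc √ℓ ≤ √(4 ^ 2 * ℓ') := Real.sqrt_le_sqrt (by linarith)
      _ = _ := by rw [Real.sqrt_mul (by norm_num), Real.sqrt_sq (by norm_num)]
  unfold rate
  calc _ ≤ (√(L₁ * Δ) + σ₁) / (T : ℝ) ^ (min (expo₁ p) (expo₂ p q)) * (4 * ℓ') +
        √(δ * Δ) / (T : ℝ) ^ (expo₂ p q) * (4 * √ℓ') := by gcongr
    _ = _ := by ring

lemma rate_nonneg (hσ : 0 ≤ σ₁) (hℓ : 0 ≤ ℓ) : 0 ≤ rate L₁ σ₁ δ Δ p q T ℓ := by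
  unfold rate
  positivity

end Parameters

end ClippedMVR

end

/-! ### Assembly on the good event -/

open ClippedMVR in
/-- Pathwise consequence of the noise bound. -/
lemma ClippedMVR.NoiseLevel.sum_norm_gradient_le {d : ℕ} {Ξ : Type*} [MeasurableSpace Ξ]
    {D : Measure Ξ} [IsProbabilityMeasure D] {F : Pt d → ℝ} {G : Pt d → Ξ → Pt d} {x₀ : Pt d}
    {L₁ p q α lam₁ lam₂ γ Δ r : ℝ} {T : ℕ} {s : ℕ → Ξ}
    (h : NoiseLevel D F G p q α lam₁ lam₂ γ) (hLip : LipschitzGradient F L₁) (hL : 0 < L₁)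
    (hF : BddBelow (Set.range F)) (hG : Measurable (Function.uncurry G))
    (hp₁ : 1 ≤ p) (hp₂ : p ≤ 2) (hq₁ : 1 ≤ q) (hq₂ : q ≤ 2)
    (hα₀ : 0 < α) (hα₁ : α ≤ 1) (h₁ : 0 < lam₁) (h₂ : 0 < lam₂) (hγ : 0 ≤ γ) (hr : 0 ≤ r)
    (hΔ : initialGap F x₀ = Δ) (hlam₁ : 2 * γ * L₁ ≤ lam₁) (hlam₂ : 4 * √(L₁ * Δ) ≤ lam₂)
    (hS : ∀ t < T, ‖noise G x₀ 0 γ α lam₁ lam₂ s D t‖ ≤ r)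
    (hbudget : 2 * γ * (‖gradient F x₀‖ / α + T * (2 * (lam₁ + α * lam₂) + r)) +
      T * (L₁ * γ ^ 2 / 2) ≤ Δ) :
    γ * ∑ t ∈ Finset.range T, ‖gradient F (iterate G x₀ 0 γ α lam₁ lam₂ s t)‖ ≤ 2 * Δ := by
  refine hLip.sum_norm_gradient_le hF (x := iterate G x₀ 0 γ α lam₁ lam₂ s)
    (g := fun t => (run G x₀ 0 γ α lam₁ lam₂ s t).momentum)
    (S := fun t => noise G x₀ 0 γ α lam₁ lam₂ s D t) (B := lam₁ + α * lam₂)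
    hγ hα₀ hα₁ (by positivity) hr (fun t => run_next G x₀ 0 γ α lam₁ lam₂ s t) rfl rfl hΔ
    (fun t hgap => ?_) hS hbudget
  set z := pointPair G x₀ 0 γ α lam₁ lam₂ s t with hz
  have hz₁ : iterate G x₀ 0 γ α lam₁ lam₂ s (t + 1) = z.1 := rfl
  have hz₂ : iterate G x₀ 0 γ α lam₁ lam₂ s t = z.2 := rfl
  rw [hz₁] at hgap
  have hdist : ‖z.1 - z.2‖ ≤ γ := norm_pointPair_sub_le G x₀ 0 α lam₁ lam₂ s hγ t
  -- A gap of 2Δ gives ‖∇F‖² ≤ 4L₁Δ; this is the origin of the constant 4 in the threshold.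
  have hgrad : ‖gradient F z.1‖ ≤ lam₂ / 2 := by
    have h3 : ‖gradient F z.1‖ ^ 2 ≤ (2 * √(L₁ * Δ)) ^ 2 := by
      have hΔ₀ : 0 ≤ Δ := hΔ ▸ sub_nonneg.2 (ciInf_le hF x₀)
      rw [mul_pow, Real.sq_sqrt (by positivity)]
      have h4 := hLip.sq_norm_gradient_le hL hF z.1
      have h5 : 2 * L₁ * initialGap F z.1 ≤ 2 * L₁ * (2 * Δ) := by gcongr
      linarith
    have h4 := (abs_le_of_sq_le_sq' h3 (by positivity)).2
    linarith
  have hdiff : ‖gradient F z.1 - gradient F z.2‖ ≤ lam₁ / 2 := by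
    have h3 : L₁ * ‖z.1 - z.2‖ ≤ L₁ * γ := by gcongr
    have h4 := hLip.2.2 z.1 z.2
    linarith
  have hmean := h.norm_meanDirection_sub_le hG hp₁ hp₂ hq₁ hq₂ hα₀.le hα₁ h₁ h₂ hdist hdiff hgrad
  rw [hz₁, hz₂]
  refine le_of_eq_of_le (congrArg norm ?_) hmean
  rw [run_momentum_succ, noise, ← hz]
  -- The samples cancel between momentum and noise; only the mean direction minus its target is
  -- left.
  module

open ClippedMVR in
theorem mainTheorem11 :
    ∃ c₀ C : ℝ, 0 < c₀ ∧ 0 < C ∧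
      ∀ (d : ℕ) (Ω Ξ : Type*) [MeasurableSpace Ω] [MeasurableSpace Ξ]
        (μ : Measure Ω) [IsProbabilityMeasure μ] (D : Measure Ξ) [IsProbabilityMeasure D]
        (ξ : ℕ → Ω → Ξ) (F : Pt d → ℝ) (G : Pt d → Ξ → Pt d) (x₀ : Pt d)
        (L₁ σ₁ δ p q β : ℝ) (T : ℕ),
        IIDSamples μ D ξ →
        Measurable (Function.uncurry G) →
        1 < p → p ≤ 2 → 1 ≤ q → q ≤ 2 →
        BddBelow (Set.range F) →
        LipschitzGradient F L₁ →
        BoundedCentralMoment D F G p σ₁ →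
        Similarity D F G q δ →
        1 ≤ T → 0 < β → β ≤ 1 →
        ∀ Δ α M γ : ℝ,
          Δ = initialGap F x₀ →
          α = momentumParam p q T →
          M = stepScale L₁ σ₁ δ Δ p q α T (Real.log (8 * T / β)) →
          0 < γ → γ ≤ c₀ * M →
          ∀ avg : Ω → ℝ,
            (∀ ω, avg ω = avgGradNorm F
              (iterate G x₀ 0 γ α (threshold₁ L₁ δ q α γ) (threshold₂ L₁ σ₁ Δ p α)
                (fun t => ξ t ω)) T) →
            1 - β ≤ μ.real {ω | avg ω ≤ 2 * Δ / (γ * T)} ∧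
            ∀ c : ℝ, 0 < c → c * M ≤ γ →
              1 - β ≤ μ.real
                {ω | avg ω ≤ C / c * rate L₁ σ₁ δ Δ p q T (Real.log (8 * T / β))} ∧
              (2 * β ≤ T →
                1 - β ≤ μ.real
                  {ω | avg ω ≤ C / c * rate L₁ σ₁ δ Δ p q T (Real.log (T / β))}) := by
  -- 8 = 2 · 4: the 2 of the bound 2Δ/(γT), and the 4 lost in passing from log(8T/β) to log(T/β).
  refine ⟨1 / 100, 8, by norm_num, by norm_num, ?_⟩
  intro d Ω Ξ _ _ μ _ D _ ξ F G x₀ L₁ σ₁ δ p q β T hξ hG hp₁ hp₂ hq₁ hq₂ hF hLip hc hs hT hβ₀ hβ₁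
    Δ α M γ hΔ hα hM hγ hγM avg havg
  have hM₀ : 0 < M := by linarith
  have hΔ₀ : 0 ≤ Δ := hΔ ▸ sub_nonneg.2 (ciInf_le hF x₀)
  obtain ⟨hL, hΔpos⟩ := pos_of_stepScale_pos hLip.1 hΔ₀ (hM ▸ hM₀)
  have hσ := hc.1
  have hδ := hs.1
  have hα₀ : 0 < α := hα ▸ momentumParam_pos hT
  have hα₁ : α ≤ 1 := hα ▸ momentumParam_le_one hp₁ hq₁ hT
  have hℓ := one_le_log hT hβ₀ hβ₁
  have hT' : (0 : ℝ) < T := by positivity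
  set lam₁ := threshold₁ L₁ δ q α γ
  set lam₂ := threshold₂ L₁ σ₁ Δ p α
  have hlam₁ : 2 * γ * L₁ ≤ lam₁ := le_max_left _ _
  have hlam₂ : 4 * √(L₁ * Δ) ≤ lam₂ := le_max_left _ _
  have h₁ : 0 < lam₁ := lt_of_lt_of_le (by positivity) hlam₁
  have h₂ : 0 < lam₂ := lt_of_lt_of_le (by positivity) hlam₂
  have hnoise : NoiseLevel D F G p q α lam₁ lam₂ γ := noiseLevel hc hs hp₁ hq₁ hα₀ hγ.le
  have hgrad : ‖gradient F x₀‖ ≤ 2 * √(L₁ * Δ) := by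
    have h3 : ‖gradient F x₀‖ ^ 2 ≤ (2 * √(L₁ * Δ)) ^ 2 := by
      rw [mul_pow, Real.sq_sqrt (by positivity)]
      have h4 := hLip.sq_norm_gradient_le hL hF x₀
      have h5 : 0 ≤ L₁ * Δ := by positivity
      rw [← hΔ] at h4
      linarith
    exact (abs_le_of_sq_le_sq' h3 (by positivity)).2
  have hbudget := stepsize_budget hL hΔpos hσ hδ hp₁ hα₀ hT hℓ hγ (hM ▸ hγM) hgrad
  have hmain : 1 - β ≤ μ.real {ω | avg ω ≤ 2 * Δ / (γ * T)} := by
    refine (hnoise.le_measureReal_forall_norm_noise_le (x₀ := x₀) (g₀ := 0) hξ hG hp₁.le hp₂ hq₁ hq₂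
      hα₀.le hα₁ h₁ h₂ hγ.le hT hβ₀).trans (measureReal_mono fun ω hω => ?_)
    have h3 := hnoise.sum_norm_gradient_le hLip hL hF hG hp₁.le hp₂ hq₁ hq₂ hα₀ hα₁ h₁ h₂ hγ.le
      (by positivity) hΔ.symm hlam₁ hlam₂ hω hbudget
    rw [Set.mem_ofPred_eq, havg, avgGradNorm, le_div_iff₀ (by positivity)]
    calc _ = γ * ∑ t ∈ Finset.range T,
          ‖gradient F (iterate G x₀ 0 γ α lam₁ lam₂ (fun t => ξ t ω) t)‖ := by field_simp
      _ ≤ _ := h3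
  refine ⟨hmain, fun c hc₀ hcM => ?_⟩
  have hrate₀ : 0 ≤ rate L₁ σ₁ δ Δ p q T (Real.log (8 * T / β)) :=
    rate_nonneg hσ.le (by linarith)
  have hrate : 2 * Δ / (γ * T) ≤ 2 / c * rate L₁ σ₁ δ Δ p q T (Real.log (8 * T / β)) := by
    have h3 := gap_le_stepScale_mul_rate hL hΔpos hσ hδ hp₁ hq₁ hT hℓ
    rw [← hα, ← hM] at h3
    rw [div_le_iff₀ (by positivity)]
    calc 2 * Δ ≤ 2 * (M * (T * rate L₁ σ₁ δ Δ p q T (Real.log (8 * T / β)))) := by gcongr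
      _ = 2 / c * rate L₁ σ₁ δ Δ p q T (Real.log (8 * T / β)) * (c * M * T) := by field_simp
      _ ≤ _ := by gcongr
  refine ⟨hmain.trans (measureReal_mono fun ω hω => le_trans hω (hrate.trans ?_)), fun h2β =>
    hmain.trans (measureReal_mono fun ω hω => le_trans hω (hrate.trans ?_))⟩
  · gcongr
    norm_num
  · have hlog := log_le_four_mul_log hT hβ₀ h2β
    calc _ ≤ 2 / c * (4 * rate L₁ σ₁ δ Δ p q T (Real.log (T / β))) := by
          gcongr
          exact rate_le_four_mul_rate hσ.le (by linarith) hlog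
      _ = _ := by ring
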